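/- **Setting.** Let $d\ge 1$, let $\mathbf z$ be a random vector with $d$-dimensional subvector $\mathbf w$, and let $\mathbf z_1,\mathbf z_2$ be independent copies of $\mathbf z$, with subvectors $\mathbf w_1,\mathbf w_2$. Let $\mathcal W$ be the (closed) support of $\mathbf w$. Conditional expectations are computed from a fixed regular conditional distribution of $\mathbf z$ given $\mathbf w$. Limits in the value of $\mathbf w_2$ are taken inside $\mathcal W$. Let $\Theta\subseteq\mathbb R^k$, $\boldsymbol\theta_0\in\mathbb R^k$, and let $m(\cdot,\cdot;\boldsymbol\theta)\in\mathbb R$, $\mathbf s(\cdot,\cdot;\boldsymbol\theta)\in\mathbb R^k$, $\mathbf H(\cdot,\cdot;\boldsymbol\theta,\mathbf t)\in\mathbb R^{k\times k}$ be measurable. For $h>0$ put $K_h(\mathbf u)=h^{-d}K(\mathbf u/h)$ and $$M(\boldsymbol\theta;h)=\mathbb E[m(\mathbf z_1,\mathbf z_2;\boldsymbol\theta)K_h(\mathbf w_1-\mathbf w_2)].$$ **Assumption 1.** (i) $K$ is a symmetric ($K(-\mathbf u)=K(\mathbf u)$), bounded probability density on $\mathbb R^d$. (ii) $\Theta$ is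 convex, $m(\cdot,\cdot;\boldsymbol\theta)$ is permutation symmetric for $\boldsymbol\theta\in\Theta$, and $\boldsymbol\theta\mapsto m(\mathbf z_1,\mathbf z_2;\boldsymbol\theta)$ is convex on $\Theta$ with probability one. (iii) $\mathbf w$ has a Lebesgue density $f_{\mathbf w}$, which is bounded and continuous on $\mathcal W$ and zero off $\mathcal W$. (iv) For each $\boldsymbol\theta\in\Theta$, $m(\mathbf z_1,\mathbf z_2;\boldsymbol\theta)$ is integrable, the positive part of $\sup_{\mathbf v\in\mathcal W}\mathbb E[m(\mathbf z_1,\mathbf z_2;\boldsymbol\theta)|\mathbf w_1=\mathbf w,\mathbf w_2=\mathbf v]f_{\mathbf w}(\mathbf v)$ has finite expectation, and, with probability one, $$\lim_{\mathbf u\to\mathbf 0}\mathbb E[m(\mathbf z_1,\mathbf z_2;\boldsymbol\theta)|\mathbf w_1=\mathbf w,\mathbf w_2=\mathbf w+\mathbf u]=\mathbb E[m(\mathbf z_1,\mathbf z_2;\boldsymbol\theta)|\mathbf w_1=\mathbf w,\mathbf w_2=\mathbf w].$$ (v) On $\Theta$ the function $M_0(\boldsymbol\theta)=\int_{\mathcal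 W}\mathbb E[m(\mathbf z_1,\mathbf z_2;\boldsymbol\theta)|\mathbf w_1=\mathbf w,\mathbf w_2=\mathbf w]f_{\mathbf w}(\mathbf w)^2d\mathbf w$ is well defined and finite, and it is uniquely minimized at $\boldsymbol\theta_0$, an interior point of $\Theta$. **Assumption 2.** For $\mathbf t\in\mathbb R^k$ put $$r_{\mathbf t}(\boldsymbol\theta,\tau)=\frac{m(\mathbf z_1,\mathbf z_2;\boldsymbol\theta+\mathbf t\tau)-m(\mathbf z_1,\mathbf z_2;\boldsymbol\theta)}{\tau}-\mathbf s(\mathbf z_1,\mathbf z_2;\boldsymbol\theta)'\mathbf t,\qquad R_{\mathbf t}(\boldsymbol\theta,\tau)=\frac{\mathbb E[r_{\mathbf t}(\boldsymbol\theta,\tau)|\mathbf w_1,\mathbf w_2]}{\tau}-\tfrac12\mathbf t'\mathbf H(\mathbf w_1,\mathbf w_2;\boldsymbol\theta,\mathbf t)\mathbf t .$$ (i) For each $\mathbf t$ there is $\delta>0$ such that, with suprema over $\tau\in(0,\delta)$, $\|\boldsymbol\theta-\boldsymbol\theta_0\|<\delta$, $\mathbf w_2\in\mathcal W$, the expectations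 $$\mathbb E\big[\sup|\mathbb E[r_{\mathbf t}(\boldsymbol\theta,\tau)|\mathbf z_1,\mathbf w_2]|f_{\mathbf w}(\mathbf w_2)^2\big],\quad \mathbb E\big[\sup\mathbb E[r_{\mathbf t}(\boldsymbol\theta,\tau)^2|\mathbf w_1,\mathbf w_2]f_{\mathbf w}(\mathbf w_2)\big],\quad \mathbb E\big[\sup|R_{\mathbf t}(\boldsymbol\theta,\tau)|f_{\mathbf w}(\mathbf w_2)\big]$$ are finite; and, with probability one, $\mathbb E[r_{\mathbf t}(\boldsymbol\theta,\tau)|\mathbf z_1=\mathbf z,\mathbf w_2=\mathbf w+\mathbf u]$, $\mathbb E[r_{\mathbf t}(\boldsymbol\theta,\tau)^2|\mathbf w_1=\mathbf w,\mathbf w_2=\mathbf w+\mathbf u]$ and $\mathbb E[R_{\mathbf t}(\boldsymbol\theta,\tau)|\mathbf w_1=\mathbf w,\mathbf w_2=\mathbf w+\mathbf u]$ tend to $0$ as $\tau\downarrow0$, $(\boldsymbol\theta,\mathbf u)\to(\boldsymbol\theta_0,\mathbf 0)$. (ii) There are $\delta>0$ and a function $b$ such that, with probability one, $\sup_{\|\boldsymbol\theta-\boldsymbol\theta_0\|<\delta}\|\mathbf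 s(\mathbf z_1,\mathbf z_2;\boldsymbol\theta)\|\le b(\mathbf z_1)b(\mathbf z_2)$, with $\mathbb E[b(\mathbf z)^4]+\sup_{\mathbf w\in\mathcal W}\mathbb E[b(\mathbf z)^4|\mathbf w]f_{\mathbf w}(\mathbf w)<\infty$ and $\mathbb E[\sup_{\|\boldsymbol\theta-\boldsymbol\theta_0\|<\delta,\mathbf w_2\in\mathcal W}\|\mathbf H(\mathbf w_1,\mathbf w_2;\boldsymbol\theta,\mathbf t)\|f_{\mathbf w}(\mathbf w_2)]<\infty$ for each $\mathbf t$. (iii) There are functions $\mathbf G_0,\boldsymbol\xi_0,\boldsymbol\Xi_0$ such that, for each $\mathbf t$ and with probability one, $$\lim_{(\boldsymbol\theta,\mathbf u)\to(\boldsymbol\theta_0,\mathbf 0)}\mathbf H(\mathbf w,\mathbf w+\mathbf u;\boldsymbol\theta,\mathbf t)f_{\mathbf w}(\mathbf w)=\mathbf G_0(\mathbf w),$$ $$\lim_{(\boldsymbol\theta,\mathbf u)\to(\boldsymbol\theta_0,\mathbf 0)}2\,\mathbb E[\mathbf s(\mathbf z_1,\mathbf z_2;\boldsymbol\theta)|\mathbf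 z_1=\mathbf z,\mathbf w_2=\mathbf w+\mathbf u]f_{\mathbf w}(\mathbf w)=\boldsymbol\xi_0(\mathbf z),$$ $$\lim_{(\boldsymbol\theta,\bar{\boldsymbol\theta},\mathbf u)\to(\boldsymbol\theta_0,\boldsymbol\theta_0,\mathbf 0)}\mathbb E[\mathbf s(\mathbf z_1,\mathbf z_2;\boldsymbol\theta)\mathbf s(\mathbf z_1,\mathbf z_2;\bar{\boldsymbol\theta})'|\mathbf w_1=\mathbf w,\mathbf w_2=\mathbf w+\mathbf u]f_{\mathbf w}(\mathbf w)=\boldsymbol\Xi_0(\mathbf w).$$ (iv) $\mathbb E[\mathbf G_0(\mathbf w)]$, $\mathbb E[\boldsymbol\xi_0(\mathbf z)\boldsymbol\xi_0(\mathbf z)']$ and $\mathbb E[\boldsymbol\Xi_0(\mathbf w)]$ exist and are positive definite. **Proposition.** Suppose Assumptions 1 and 2 hold and that (i) $\int_{\mathbb R^d}\|\mathbf u\|^2K(\mathbf u)\,d\mathbf u<\infty$, and (ii) with probability one, $\mathbf v\mapsto\boldsymbol\psi(\mathbf w,\mathbf v)=\mathbb E[\mathbf s(\mathbf z_1,\mathbf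 z_2;\boldsymbol\theta_0)|\mathbf w_1=\mathbf w,\mathbf w_2=\mathbf v]f_{\mathbf w}(\mathbf v)$ (which is zero for $\mathbf v\notin\mathcal W$) is twice continuously differentiable on $\mathbb R^d$, with $\mathbb E[\sup_{\mathbf v\in\mathcal W}\|\partial_{\mathbf v}^{\boldsymbol\alpha}\boldsymbol\psi(\mathbf w,\mathbf v)\|]<\infty$ for all multi-indices $\boldsymbol\alpha\in\mathbb Z_+^d$ with $|\boldsymbol\alpha|\le2$. Then $\operatorname{argmin}_{\boldsymbol\theta\in\Theta}M(\boldsymbol\theta;h)$ is non-empty for all sufficiently small $h>0$, and there is $\mathbf b_2\in\mathbb R^k$ such that every choice of $\boldsymbol\theta(h)\in\operatorname{argmin}_{\boldsymbol\theta\in\Theta}M(\boldsymbol\theta;h)$ (for $h>0$ near zero) satisfies $$\boldsymbol\theta(h)-\boldsymbol\theta_0=\mathbf b_2h^2+o(h^2)\qquad\text{as }h\downarrow0 .$$ -/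

import Mathlib

open MeasureTheory ProbabilityTheory Filter Topology
open scoped ENNReal Asymptotics

noncomputable section

namespace PairwiseDiff

/-- `ℝⁿ` with the Euclidean norm. -/
abbrev RVec (n : ℕ) : Type := EuclideanSpace ℝ (Fin n)

/-- The expectation under `μ` of the `[0, ∞]`-valued function `g` is finite. As `g` may be a supremum
over an uncountable family, this is phrased through a measurable majorant; for an
a.e.-measurable `g` it says exactly that `∫⁻ g ∂μ < ∞`. -/
def FiniteMean {α : Type*} [MeasurableSpace α] (μ : Measure α) (g : α → ℝ≥0∞) : Prop :=
  ∃ G : α → ℝ≥0∞, Measurable G ∧ (∀ᵐ x ∂μ, g x ≤ G x) ∧ ∫⁻ x, G x ∂μ < ∞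

/-- The Frobenius norm of a matrix. -/
def matNorm {k : ℕ} (A : Matrix (Fin k) (Fin k) ℝ) : ℝ := √(∑ i, ∑ j, A i j ^ 2)

/-- The quadratic form `t' A t`. -/
def quadForm {k : ℕ} (A : Matrix (Fin k) (Fin k) ℝ) (t : RVec k) : ℝ :=
  ∑ i, ∑ j, t i * A i j * t j

/-- The partial derivative `∂ⁿ g / ∂v_{i 0} ⋯ ∂v_{i (n - 1)}` at `v`. For a function of class `Cⁿ` these
are, over all `i : Fin n → Fin d`, the derivatives `∂^α g` with `|α| = n`. -/
def partialDeriv {d k n : ℕ} (i : Fin n → Fin d) (g : RVec d → RVec k) (v : RVec d) : RVec k :=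
  iteratedFDeriv ℝ n g v (fun l => EuclideanSpace.single (i l) (1 : ℝ))

/-- The distribution of a random vector `z` with values in `Z`, together with its `d`-dimensional
subvector `w`, a Lebesgue density `f` of `w` (zero off the support of `w`), and a regular conditional
distribution `κ` of `z` given `w`. -/
structure Population (d : ℕ) (Z : Type*) [MeasurableSpace Z] where
  /-- the law of `z` -/
  P : Measure Z
  isProbabilityMeasure : IsProbabilityMeasure P
  /-- the subvector `w` of `z` -/
  w : Z → RVec d
  measurable_w : Measurable w
  /-- the Lebesgue density of `w` -/
  f : RVec d → ℝ
  measurable_f : Measurable f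
  f_nonneg : ∀ a, 0 ≤ f a
  law_w : P.map w = volume.withDensity (fun a => ENNReal.ofReal (f a))
  f_eq_zero : ∀ a, a ∉ (P.map w).support → f a = 0
  /-- a regular conditional distribution of `z` given `w` -/
  κ : Kernel (RVec d) Z
  isMarkovKernel : IsMarkovKernel κ
  disintegration : P.map (fun z => (w z, z)) = (P.map w) ⊗ₘ κ

namespace Population

variable {d k : ℕ} {Z : Type*} [MeasurableSpace Z] (D : Population d Z)

/-- The law of `w`. -/
def lawW : Measure (RVec d) := D.P.map D.w

/-- The support `𝒲` of `w`. -/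
def supp : Set (RVec d) := D.lawW.support

/-- The joint law of two independent copies `z₁, z₂` of `z`. -/
def pairLaw : Measure (Z × Z) := D.P.prod D.P

/-- The joint law of `z₁, z₂` conditional on `w₁ = a`, `w₂ = v`. -/
def condPairLaw (a v : RVec d) : Measure (Z × Z) := (D.κ a).prod (D.κ v)

/-- `E[g(z₁, z₂) | w₁ = a, w₂ = v]`. -/
def condPair {E : Type*} [NormedAddCommGroup E] [NormedSpace ℝ E] (g : Z → Z → E)
    (a v : RVec d) : E :=
  ∫ p, g p.1 p.2 ∂(D.condPairLaw a v)

/-- `E[g(z₁, z₂) | z₁ = x, w₂ = v]`. -/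
def condFst {E : Type*} [NormedAddCommGroup E] [NormedSpace ℝ E] (g : Z → Z → E)
    (x : Z) (v : RVec d) : E :=
  ∫ y, g x y ∂(D.κ v)

/-- `E[g(z₁, z₂)² | w₁ = a, w₂ = v]`, with value in `[0, ∞]`. -/
def condSq (g : Z → Z → ℝ) (a v : RVec d) : ℝ≥0∞ :=
  ∫⁻ p, ENNReal.ofReal (g p.1 p.2 ^ 2) ∂(D.condPairLaw a v)

/-- The objective `M(θ; h) = E[m(z₁, z₂; θ) K_h(w₁ - w₂)]` with `K_h(u) = h⁻ᵈ K(u / h)`. -/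
def M (m : Z → Z → RVec k → ℝ) (K : RVec d → ℝ) (θ : RVec k) (h : ℝ) : ℝ :=
  ∫ p, m p.1 p.2 θ * ((h ^ d)⁻¹ * K (h⁻¹ • (D.w p.1 - D.w p.2))) ∂D.pairLaw

/-- The set `argmin_{θ ∈ Θ} M(θ; h)`. -/
def argminM (m : Z → Z → RVec k → ℝ) (Θ : Set (RVec k)) (K : RVec d → ℝ) (h : ℝ) :
    Set (RVec k) :=
  {θ | θ ∈ Θ ∧ ∀ θ' ∈ Θ, D.M m K θ h ≤ D.M m K θ' h}

/-- The integrand `E[m(z₁, z₂; θ) | w₁ = a, w₂ = a] f(a)²` of `M₀(θ)`. -/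
def M₀Integrand (m : Z → Z → RVec k → ℝ) (θ : RVec k) (a : RVec d) : ℝ :=
  D.condPair (fun x y => m x y θ) a a * D.f a ^ 2

/-- The limiting objective `M₀(θ)`. -/
def M₀ (m : Z → Z → RVec k → ℝ) (θ : RVec k) : ℝ :=
  ∫ a in D.supp, D.M₀Integrand m θ a

/-- The function `ψ(a, v) = E[s(z₁, z₂; θ₀) | w₁ = a, w₂ = v] f(v)`. -/
def ψ (s : Z → Z → RVec k → RVec k) (θ₀ : RVec k) (a v : RVec d) : RVec k :=
  D.f v • D.condPair (fun x y => s x y θ₀) a v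

/-- The remainder `R_t(θ, τ)` as a function of `w₁ = a`, `w₂ = v`, where `r θ τ` is the remainder
`r_t(θ, τ)` as a function of `z₁, z₂`. -/
def remR (r : RVec k → ℝ → Z → Z → ℝ)
    (H : RVec d → RVec d → RVec k → RVec k → Matrix (Fin k) (Fin k) ℝ)
    (t θ : RVec k) (τ : ℝ) (a v : RVec d) : ℝ :=
  D.condPair (r θ τ) a v / τ - 1 / 2 * quadForm (H a v θ t) t

end Population

/-- The remainder `r_t(θ, τ)` as a function of `z₁, z₂`. -/
def remr {k : ℕ} {Z : Type*} (m : Z → Z → RVec k → ℝ) (s : Z → Z → RVec k → RVec k)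
    (t θ : RVec k) (τ : ℝ) (x y : Z) : ℝ :=
  (m x y (θ + τ • t) - m x y θ) / τ - inner ℝ (s x y θ) t

/-- The filter `τ ↓ 0`, `(θ, v) → (θ₀, a)` with `v` in `S`. -/
def limTauThetaV {d k : ℕ} (S : Set (RVec d)) (θ₀ : RVec k) (a : RVec d) :
    Filter (ℝ × RVec k × RVec d) :=
  𝓝[>] (0 : ℝ) ×ˢ (𝓝 θ₀ ×ˢ 𝓝[S] a)

/-- The (punctured) filter `(θ, v) → (θ₀, a)` with `v` in `S`. -/
def limThetaV {d k : ℕ} (S : Set (RVec d)) (θ₀ : RVec k) (a : RVec d) :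
    Filter (RVec k × RVec d) :=
  𝓝[{q | q.2 ∈ S ∧ q ≠ (θ₀, a)}] (θ₀, a)

/-- The (punctured) filter `(θ, θ', v) → (θ₀, θ₀, a)` with `v` in `S`. -/
def limThetaThetaV {d k : ℕ} (S : Set (RVec d)) (θ₀ : RVec k) (a : RVec d) :
    Filter (RVec k × RVec k × RVec d) :=
  𝓝[{q | q.2.2 ∈ S ∧ q ≠ (θ₀, θ₀, a)}] (θ₀, θ₀, a)

/-- Conditions under which `M(θ; h)` converges to `M₀(θ)` as `h ↓ 0`. Limits in `w₂` are
taken inside the support of `w`, outside of which there is no conditional expectation. -/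
structure ConvergenceOfM {d k : ℕ} {Z : Type*} [MeasurableSpace Z] (D : Population d Z)
    (m : Z → Z → RVec k → ℝ) (Θ : Set (RVec k)) (K : RVec d → ℝ) (θ₀ : RVec k) : Prop where
  -- the kernel is a symmetric, bounded probability density
  K_symm : ∀ u, K (-u) = K u
  K_bounded : ∃ C : ℝ, ∀ u, K u ≤ C
  K_nonneg : ∀ u, 0 ≤ K u
  K_measurable : Measurable K
  K_integral : ∫⁻ u, ENNReal.ofReal (K u) = 1
  -- convexity and permutation symmetry
  Θ_convex : Convex ℝ Θ
  m_measurable : ∀ θ ∈ Θ, Measurable (fun p : Z × Z => m p.1 p.2 θ)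
  m_symm : ∀ θ ∈ Θ, ∀ x y, m x y θ = m y x θ
  m_convex : ∀ᵐ p ∂D.pairLaw, ConvexOn ℝ Θ (m p.1 p.2)
  -- the density of `w` is bounded, and continuous on the support of `w`
  f_bounded : ∃ C : ℝ, ∀ a, D.f a ≤ C
  f_continuousOn : ContinuousOn D.f D.supp
  -- moments and continuity at the diagonal
  m_integrable : ∀ θ ∈ Θ, Integrable (fun p : Z × Z => m p.1 p.2 θ) D.pairLaw
  m_sup : ∀ θ ∈ Θ, FiniteMean D.lawW (fun a => ⨆ v ∈ D.supp,
    ENNReal.ofReal (D.condPair (fun x y => m x y θ) a v * D.f v))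
  m_lim : ∀ θ ∈ Θ, ∀ᵐ a ∂D.lawW,
    Tendsto (fun v => D.condPair (fun x y => m x y θ) a v) (𝓝[D.supp] a)
      (𝓝 (D.condPair (fun x y => m x y θ) a a))
  -- `M₀` is well defined, and uniquely minimized over `Θ` at an interior point `θ₀`
  M₀_integrable : ∀ θ ∈ Θ, IntegrableOn (D.M₀Integrand m θ) D.supp
  θ₀_interior : θ₀ ∈ interior Θ
  θ₀_unique_min : ∀ θ ∈ Θ, θ ≠ θ₀ → D.M₀ m θ₀ < D.M₀ m θ

/-- Existence of the limits `G₀`, `ξ₀`, `Ξ₀`, with `E[G₀(w)]`, `E[ξ₀(z) ξ₀(z)']` and `E[Ξ₀(w)]`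
positive definite. -/
structure VarianceIngredients {d k : ℕ} {Z : Type*} [MeasurableSpace Z] (D : Population d Z)
    (s : Z → Z → RVec k → RVec k)
    (H : RVec d → RVec d → RVec k → RVec k → Matrix (Fin k) (Fin k) ℝ) (θ₀ : RVec k)
    (G₀ : RVec d → Matrix (Fin k) (Fin k) ℝ) (ξ₀ : Z → RVec k)
    (Ξ₀ : RVec d → Matrix (Fin k) (Fin k) ℝ) : Prop where
  G₀_lim : ∀ t : RVec k, ∀ᵐ a ∂D.lawW,
    Tendsto (fun q : RVec k × RVec d => D.f a • H a q.2 q.1 t) (limThetaV D.supp θ₀ a) (𝓝 (G₀ a))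
  ξ₀_lim : ∀ᵐ z ∂D.P,
    Tendsto (fun q : RVec k × RVec d =>
        (2 * D.f (D.w z)) • D.condFst (fun x y => s x y q.1) z q.2)
      (limThetaV D.supp θ₀ (D.w z)) (𝓝 (ξ₀ z))
  Ξ₀_lim : ∀ᵐ a ∂D.lawW,
    Tendsto (fun q : RVec k × RVec k × RVec d =>
        D.f a • (Matrix.of fun i j : Fin k =>
          D.condPair (fun x y => s x y q.1 i * s x y q.2.1 j) a q.2.2))
      (limThetaThetaV D.supp θ₀ a) (𝓝 (Ξ₀ a))
  G₀_integrable : ∀ i j, Integrable (fun a => G₀ a i j) D.lawW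
  ξ₀_integrable : ∀ i j, Integrable (fun z => ξ₀ z i * ξ₀ z j) D.P
  Ξ₀_integrable : ∀ i j, Integrable (fun a => Ξ₀ a i j) D.lawW
  Γ₀_posDef : (Matrix.of fun i j : Fin k => ∫ a, G₀ a i j ∂D.lawW).PosDef
  Sigma₀_posDef : (Matrix.of fun i j : Fin k => ∫ z, ξ₀ z i * ξ₀ z j ∂D.P).PosDef
  EΞ₀_posDef : (Matrix.of fun i j : Fin k => ∫ a, Ξ₀ a i j ∂D.lawW).PosDef

/-- Conditions on the derivative-like functions `s` and `H`. -/
structure DerivativeConditions {d k : ℕ} {Z : Type*} [MeasurableSpace Z] (D : Population d Z)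
    (m : Z → Z → RVec k → ℝ) (s : Z → Z → RVec k → RVec k)
    (H : RVec d → RVec d → RVec k → RVec k → Matrix (Fin k) (Fin k) ℝ) (θ₀ : RVec k) : Prop where
  s_measurable : ∀ θ, Measurable (fun p : Z × Z => s p.1 p.2 θ)
  H_measurable : ∀ θ t i j, Measurable (fun q : RVec d × RVec d => H q.1 q.2 θ t i j)
  -- domination of the remainders
  rem_sup : ∀ t : RVec k, ∃ δ : ℝ, 0 < δ ∧
    FiniteMean D.P (fun z => ⨆ τ ∈ Set.Ioo 0 δ, ⨆ θ ∈ Metric.ball θ₀ δ, ⨆ v ∈ D.supp,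
      ENNReal.ofReal (|D.condFst (remr m s t θ τ) z v| * D.f v ^ 2)) ∧
    FiniteMean D.lawW (fun a => ⨆ τ ∈ Set.Ioo 0 δ, ⨆ θ ∈ Metric.ball θ₀ δ, ⨆ v ∈ D.supp,
      D.condSq (remr m s t θ τ) a v * ENNReal.ofReal (D.f v)) ∧
    FiniteMean D.lawW (fun a => ⨆ τ ∈ Set.Ioo 0 δ, ⨆ θ ∈ Metric.ball θ₀ δ, ⨆ v ∈ D.supp,
      ENNReal.ofReal (|D.remR (remr m s t) H t θ τ a v| * D.f v))
  -- the remainders vanish in the limit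
  rem_lim_fst : ∀ t : RVec k, ∀ᵐ z ∂D.P,
    Tendsto (fun q : ℝ × RVec k × RVec d => D.condFst (remr m s t q.2.1 q.1) z q.2.2)
      (limTauThetaV D.supp θ₀ (D.w z)) (𝓝 0)
  rem_lim_sq : ∀ t : RVec k, ∀ᵐ a ∂D.lawW,
    Tendsto (fun q : ℝ × RVec k × RVec d => D.condSq (remr m s t q.2.1 q.1) a q.2.2)
      (limTauThetaV D.supp θ₀ a) (𝓝 0)
  rem_lim_R : ∀ t : RVec k, ∀ᵐ a ∂D.lawW,
    Tendsto (fun q : ℝ × RVec k × RVec d => D.remR (remr m s t) H t q.2.1 q.1 a q.2.2)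
      (limTauThetaV D.supp θ₀ a) (𝓝 0)
  -- moment bounds
  moments : ∃ δ : ℝ, 0 < δ ∧ ∃ b : Z → ℝ, Measurable b ∧
    (∀ᵐ p ∂D.pairLaw, ∀ θ ∈ Metric.ball θ₀ δ, ‖s p.1 p.2 θ‖ ≤ b p.1 * b p.2) ∧
    ∫⁻ z, ENNReal.ofReal (b z ^ 4) ∂D.P < ∞ ∧
    (⨆ a ∈ D.supp, (∫⁻ z, ENNReal.ofReal (b z ^ 4) ∂D.κ a) * ENNReal.ofReal (D.f a)) < ∞ ∧
    ∀ t : RVec k, FiniteMean D.lawW (fun a => ⨆ θ ∈ Metric.ball θ₀ δ, ⨆ v ∈ D.supp,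
      ENNReal.ofReal (matNorm (H a v θ t) * D.f v))
  -- variance ingredients and nonsingularity
  variance : ∃ (G₀ : RVec d → Matrix (Fin k) (Fin k) ℝ) (ξ₀ : Z → RVec k)
    (Ξ₀ : RVec d → Matrix (Fin k) (Fin k) ℝ), VarianceIngredients D s H θ₀ G₀ ξ₀ Ξ₀

/-- With probability one `v ↦ ψ(w, v)` is twice continuously differentiable on `ℝᵈ`, and each of its
partial derivatives of order at most two has a supremum over the support of `w` of finite mean. -/
def SmoothPsi {d k : ℕ} {Z : Type*} [MeasurableSpace Z] (D : Population d Z)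
    (s : Z → Z → RVec k → RVec k) (θ₀ : RVec k) : Prop :=
  (∀ᵐ a ∂D.lawW, ContDiff ℝ 2 (D.ψ s θ₀ a)) ∧
  ∀ n ≤ 2, ∀ i : Fin n → Fin d,
    FiniteMean D.lawW (fun a => ⨆ v ∈ D.supp, ‖partialDeriv i (D.ψ s θ₀ a) v‖ₑ)

end PairwiseDiff

end

/-!
Since `M(·; h)` is convex, it suffices to find the pointwise limit in `t` of
`h⁻⁴ (M(θ₀ + h² t; h) - M(θ₀; h))`: if it is a quadratic polynomial with positive definite leading
part, the minimizers of the rescaled functions exist eventually and converge to the minimizer `b₂`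
of the limit.

Disintegrating over `(w₁, w₂)` and substituting `w₂ = w₁ - h u` turns a kernel-weighted expectation
into an average over `w₁` and `u ∼ K`, and the expansion of `m` at `θ₀` splits the rescaled
difference into two averages.
* The quadratic remainder is dominated and converges to `½ t' E[G₀(w)] t`. It only converges along
  `w₁ - h u` in the support, but the probability of leaving the support vanishes with `h` because
  translations are continuous in measure.
* The score term is `h⁻²` times the average of `ψ(w₁, w₁ - h u)`. Minimality of `M₀` at `θ₀` forces
  `E[ψ(w, w)] = 0`, and the symmetry of `K` removes the first-order Taylor term, so that the second
  derivative of `ψ` gives the limit.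
-/

noncomputable section

namespace PairwiseDiff

/-! ### Minimizers of convex functions that converge pointwise -/

section ConvexArgmin

variable {E : Type*} [NormedAddCommGroup E] [NormedSpace ℝ E] [FiniteDimensional ℝ E]
  {ι : Type*} {l : Filter ι} {C : ι → Set E} {q : ι → E → ℝ} {Q : E → ℝ}

lemma exists_eventually_mem_and_le (hconv : ∀ᶠ i in l, ConvexOn ℝ (C i) (q i))
    (hC : ∀ t, ∀ᶠ i in l, t ∈ C i) (hq : ∀ t, Tendsto (q · t) l (𝓝 (Q t))) (x : E) :
    ∃ B : ℝ, ∀ᶠ p in l ×ˢ 𝓝 x, p.2 ∈ C p.1 ∧ q p.1 p.2 ≤ B := by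
  obtain ⟨b, hxb, -⟩ :=
    exists_mem_interior_convexHull_affineBasis (s := Set.univ) (x := x) univ_mem
  obtain ⟨B, hB⟩ := ((Set.finite_range b).image Q).bddAbove
  have hrange : ∀ᶠ i in l, ∀ t ∈ Set.range b, t ∈ C i ∧ q i t ≤ B + 1 := by
    refine (eventually_all_finite (Set.finite_range b)).2 fun t ht => (hC t).and ?_
    have hlt : Q t < B + 1 := (hB (Set.mem_image_of_mem Q ht)).trans_lt (lt_add_one B)
    exact ((hq t).eventually_lt_const hlt).mono fun i hi => hi.le
  refine ⟨B + 1, ?_⟩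
  filter_upwards [(hconv.and hrange).prod_mk (mem_interior_iff_mem_nhds.1 hxb)]
    with ⟨i, y⟩ ⟨⟨hi, hbi⟩, hy⟩
  obtain ⟨z, hz, hyz⟩ := hi.exists_ge_of_mem_convexHull (fun t ht => (hbi t ht).1) hy
  exact ⟨convexHull_min (fun t ht => (hbi t ht).1) hi.1 hy, hyz.trans (hbi z hz).2⟩

lemma eventually_prod_nhds_lt_of_convexOn (hconv : ∀ᶠ i in l, ConvexOn ℝ (C i) (q i))
    (hC : ∀ t, ∀ᶠ i in l, t ∈ C i) (hq : ∀ t, Tendsto (q · t) l (𝓝 (Q t))) {x : E} {c : ℝ}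
    (hc : c < Q x) : ∀ᶠ p in l ×ˢ 𝓝 x, c < q p.1 p.2 := by
  obtain ⟨B, hB⟩ := exists_eventually_mem_and_le hconv hC hq x
  obtain ⟨c', hcc', hc'⟩ := exists_between hc
  obtain ⟨ε, hcε, hε⟩ : ∃ ε : ℝ, c < (1 + ε) * c' - ε * B ∧ 0 < ε := by
    have hlim : Tendsto (fun ε : ℝ => (1 + ε) * c' - ε * B) (𝓝[>] 0) (𝓝 c') := by
      refine (Continuous.tendsto' ?_ 0 c' (by simp)).mono_left nhdsWithin_le_nhds
      fun_prop
    exact ((hlim.eventually_const_lt hcc').and self_mem_nhdsWithin).exists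
  -- `x` is a convex combination of `y` and its dilated reflection `x - ε⁻¹ (y - x)`, at which
  -- `q i` is at most `B`
  have hrefl : Tendsto (fun y : E => x - ε⁻¹ • (y - x)) (𝓝 x) (𝓝 x) :=
    Continuous.tendsto' (by fun_prop) x x (by simp)
  filter_upwards [hB, (tendsto_id.prodMap hrefl).eventually hB,
    (hconv.and ((hq x).eventually_const_lt hc')).prod_inl (𝓝 x)]
    with ⟨i, y⟩ ⟨hy, _⟩ ⟨hz, hzB⟩ ⟨hi, hxi⟩
  have hcomb : (1 + ε)⁻¹ • y + (ε / (1 + ε)) • (x - ε⁻¹ • (y - x)) = x := by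
    match_scalars <;> field_simp <;> ring
  simp only [Prod.map_fst, Prod.map_snd, id] at hy hz hzB hi hxi ⊢
  set z := x - ε⁻¹ • (y - x)
  have hle := hi.2 hy hz (by positivity) (by positivity)
    (show (1 + ε)⁻¹ + ε / (1 + ε) = 1 by field_simp)
  rw [hcomb] at hle
  simp only [smul_eq_mul] at hle
  field_simp at hle
  nlinarith

theorem eventually_forall_lt_of_convexOn (hconv : ∀ᶠ i in l, ConvexOn ℝ (C i) (q i))
    (hC : ∀ t, ∀ᶠ i in l, t ∈ C i) (hq : ∀ t, Tendsto (q · t) l (𝓝 (Q t))) {x : E}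
    (hx : ∀ t, t ≠ x → Q x < Q t) {ε : ℝ} (hε : 0 < ε) :
    ∀ᶠ i in l, ∀ t ∈ C i, ε ≤ ‖t - x‖ → q i x < q i t := by
  have hsphere : ∀ᶠ i in l, ∀ t ∈ Metric.sphere x ε, q i x < q i t := by
    have hlocal : ∀ t ∈ Metric.sphere x ε, ∀ᶠ p in l ×ˢ 𝓝 t, q p.1 x < q p.1 p.2 := by
      intro t ht
      obtain ⟨c, hxc, hct⟩ := exists_between (hx t (Metric.ne_of_mem_sphere ht hε.ne'))
      filter_upwards [eventually_prod_nhds_lt_of_convexOn hconv hC hq hct,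
        ((hq x).eventually_lt_const hxc).prod_inl (𝓝 t)] with p hp hpx
      exact hpx.trans hp
    exact (Filter.Eventually.curry ((isCompact_sphere x ε).mem_prod_nhdsSet_of_forall hlocal)).mono
      fun _ h => h.self_of_nhdsSet
  filter_upwards [hconv, hC x, hsphere] with i hi hxi hsi t ht hεt
  have hpos : 0 < ‖t - x‖ := hε.trans_le hεt
  set a := ε / ‖t - x‖
  have ha₁ : a ≤ 1 := (div_le_one hpos).2 hεt
  have hmem : (1 - a) • x + a • t ∈ Metric.sphere x ε := by
    rw [mem_sphere_iff_norm, show (1 - a) • x + a • t - x = a • (t - x) by module, norm_smul,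
      Real.norm_of_nonneg (by positivity), div_mul_cancel₀ _ hpos.ne']
  by_contra! hle
  refine (hsi _ hmem).not_ge ?_
  calc q i ((1 - a) • x + a • t)
      ≤ max (q i x) (q i t) :=
        hi.le_max_of_mem_segment hxi ht ⟨1 - a, a, by linarith, by positivity, by ring, rfl⟩
    _ = q i x := max_eq_left hle

theorem eventually_exists_isMinOn_of_convexOn (hconv : ∀ᶠ i in l, ConvexOn ℝ (C i) (q i))
    (hC : ∀ t, ∀ᶠ i in l, t ∈ C i) (hq : ∀ t, Tendsto (q · t) l (𝓝 (Q t))) {x : E}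
    (hx : ∀ t, t ≠ x → Q x < Q t) : ∀ᶠ i in l, ∃ t ∈ C i, IsMinOn (q i) (C i) t := by
  have hball : ∀ᶠ i in l, Metric.closedBall x 2 ⊆ C i := by
    have hlocal : ∀ t ∈ Metric.closedBall x 2, ∀ᶠ p in l ×ˢ 𝓝 t, p.2 ∈ C p.1 := fun t _ =>
      (exists_eventually_mem_and_le hconv hC hq t).choose_spec.mono fun _ hp => hp.1
    exact (Filter.Eventually.curry
      ((isCompact_closedBall x 2).mem_prod_nhdsSet_of_forall hlocal)).mono
      fun _ h => h.self_of_nhdsSet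
  filter_upwards [hconv, hball, eventually_forall_lt_of_convexOn hconv hC hq hx one_pos]
    with i hi hCi hlt
  have hcont : ContinuousOn (q i) (Metric.closedBall x 1) :=
    ((hi.subset (Metric.ball_subset_closedBall.trans hCi) (convex_ball x 2)).continuousOn
      Metric.isOpen_ball).mono (Metric.closedBall_subset_ball (by norm_num))
  have hxmem : x ∈ Metric.closedBall x 1 := Metric.mem_closedBall_self zero_le_one
  obtain ⟨t, ht, hmin⟩ := (isCompact_closedBall x 1).exists_isMinOn ⟨x, hxmem⟩ hcont
  refine ⟨t, hCi (Metric.closedBall_subset_closedBall (by norm_num) ht), fun t' ht' => ?_⟩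
  by_cases h : t' ∈ Metric.closedBall x 1
  · exact hmin h
  · rw [mem_closedBall_iff_norm, not_le] at h
    exact (hmin hxmem).trans (hlt t' ht' h.le).le

end ConvexArgmin

section Rate

variable {E : Type*} [NormedAddCommGroup E] [NormedSpace ℝ E] {Θ : Set E} {θ₀ : E}

lemma convexOn_rescale {g : E → ℝ} (hg : ConvexOn ℝ Θ g) {c : ℝ} (hc : 0 ≤ c) (r : ℝ) :
    ConvexOn ℝ {t | θ₀ + r • t ∈ Θ} fun t => c * (g (θ₀ + r • t) - g θ₀) := by
  have hcomp := (hg.translate_right θ₀).comp_linearMap (r • (LinearMap.id : E →ₗ[ℝ] E))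
  simpa only [sub_eq_add_neg] using! (hcomp.add_const (-g θ₀)).smul hc

variable {ι : Type*} {l : Filter ι} {r : ι → ℝ}

lemma eventually_rescale_mem (hΘ : Θ ∈ 𝓝 θ₀) (hr : Tendsto r l (𝓝 0)) (t : E) :
    ∀ᶠ i in l, θ₀ + r i • t ∈ Θ := by
  have hlim : Tendsto (fun i => θ₀ + r i • t) l (𝓝 (θ₀ + (0 : ℝ) • t)) :=
    (hr.smul_const t).const_add θ₀
  rw [zero_smul, add_zero] at hlim
  exact hlim hΘ

variable [FiniteDimensional ℝ E] {F : ι → E → ℝ} {c : ι → ℝ} {Q : E → ℝ} {x : E}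

theorem eventually_exists_isMinOn_of_tendsto_rescale (hF : ∀ᶠ i in l, ConvexOn ℝ Θ (F i))
    (hΘ : Θ ∈ 𝓝 θ₀) (hr : Tendsto r l (𝓝[>] 0)) (hc : ∀ᶠ i in l, 0 < c i)
    (hlim : ∀ t, Tendsto (fun i => c i * (F i (θ₀ + r i • t) - F i θ₀)) l (𝓝 (Q t)))
    (hx : ∀ t, t ≠ x → Q x < Q t) : ∀ᶠ i in l, ∃ θ ∈ Θ, IsMinOn (F i) Θ θ := by
  have hconv : ∀ᶠ i in l, ConvexOn ℝ {t | θ₀ + r i • t ∈ Θ}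
      fun t => c i * (F i (θ₀ + r i • t) - F i θ₀) := by
    filter_upwards [hF, hc] with i hi hci
    exact convexOn_rescale hi hci.le (r i)
  obtain ⟨hr, hrpos⟩ := tendsto_nhdsWithin_iff.1 hr
  filter_upwards [eventually_exists_isMinOn_of_convexOn hconv (eventually_rescale_mem hΘ hr)
    hlim hx, hrpos, hc] with i ⟨t, ht, hmin⟩ (hri : 0 < r i) hci
  refine ⟨θ₀ + r i • t, ht, fun θ hθ => ?_⟩
  have hθ' : θ₀ + r i • ((r i)⁻¹ • (θ - θ₀)) = θ := by
    rw [smul_inv_smul₀ hri.ne', add_sub_cancel]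
  have hle := hmin (a := (r i)⁻¹ • (θ - θ₀)) (show θ₀ + r i • _ ∈ Θ from hθ'.symm ▸ hθ)
  simpa only [Set.mem_ofPred_eq, hθ', mul_le_mul_iff_right₀ hci, sub_le_sub_iff_right] using hle

theorem isLittleO_of_isMinOn_of_tendsto_rescale (hF : ∀ᶠ i in l, ConvexOn ℝ Θ (F i))
    (hΘ : Θ ∈ 𝓝 θ₀) (hr : Tendsto r l (𝓝[>] 0)) (hc : ∀ᶠ i in l, 0 < c i)
    (hlim : ∀ t, Tendsto (fun i => c i * (F i (θ₀ + r i • t) - F i θ₀)) l (𝓝 (Q t)))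
    (hx : ∀ t, t ≠ x → Q x < Q t) {θ : ι → E} (hθ : ∀ᶠ i in l, θ i ∈ Θ ∧ IsMinOn (F i) Θ (θ i)) :
    (fun i => θ i - θ₀ - r i • x) =o[l] r := by
  have hconv : ∀ᶠ i in l, ConvexOn ℝ {t | θ₀ + r i • t ∈ Θ}
      fun t => c i * (F i (θ₀ + r i • t) - F i θ₀) := by
    filter_upwards [hF, hc] with i hi hci
    exact convexOn_rescale hi hci.le (r i)
  obtain ⟨hr, hrpos⟩ := tendsto_nhdsWithin_iff.1 hr
  have hC := eventually_rescale_mem (Θ := Θ) hΘ hr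
  refine Asymptotics.isLittleO_iff.2 fun ε hε => ?_
  filter_upwards [eventually_forall_lt_of_convexOn hconv hC hlim hx hε, hC x, hθ, hrpos, hc]
    with i hlt hxΘ ⟨hθΘ, hmin⟩ (hri : 0 < r i) hci
  obtain ⟨t, ht⟩ : ∃ t, θ₀ + r i • t = θ i :=
    ⟨(r i)⁻¹ • (θ i - θ₀), by rw [smul_inv_smul₀ hri.ne', add_sub_cancel]⟩
  have htε : ‖t - x‖ < ε := by
    by_contra! hle
    have := hlt t (by rwa [ht]) hle
    rw [mul_lt_mul_iff_right₀ hci, sub_lt_sub_iff_right, ht] at this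
    exact this.not_ge (hmin hxΘ)
  rw [← ht, show θ₀ + r i • t - θ₀ - r i • x = r i • (t - x) by module, norm_smul, mul_comm]
  gcongr

end Rate

/-! ### Quadratic forms -/

section QuadForm

variable {k : ℕ}

lemma continuous_quadForm (t : RVec k) :
    Continuous fun A : Matrix (Fin k) (Fin k) ℝ => quadForm A t := by
  unfold quadForm
  fun_prop

lemma quadForm_smul (c : ℝ) (A : Matrix (Fin k) (Fin k) ℝ) (t : RVec k) :
    quadForm (c • A) t = c * quadForm A t := by
  simp only [quadForm, Finset.mul_sum, Matrix.smul_apply, smul_eq_mul]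
  exact Finset.sum_congr rfl fun i _ => Finset.sum_congr rfl fun j _ => by ring

lemma abs_quadForm_le (A : Matrix (Fin k) (Fin k) ℝ) (t : RVec k) :
    |quadForm A t| ≤ matNorm A * ‖t‖ ^ 2 := by
  have hcs := Finset.sum_mul_sq_le_sq_mul_sq Finset.univ (fun p : Fin k × Fin k => A p.1 p.2)
    fun p => t p.1 * t p.2
  simp only [← Finset.univ_product_univ, Finset.sum_product, mul_pow, ← Finset.mul_sum,
    ← Finset.sum_mul] at hcs
  refine abs_le_of_sq_le_sq ?_ (mul_nonneg (Real.sqrt_nonneg _) (sq_nonneg _))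
  calc quadForm A t ^ 2 = (∑ i, ∑ j, A i j * (t i * t j)) ^ 2 := by
        refine congrArg (· ^ 2) (Finset.sum_congr rfl fun i _ => Finset.sum_congr rfl fun j _ => ?_)
        ring
    _ ≤ (∑ i, ∑ j, A i j ^ 2) * ((∑ i, t i ^ 2) * ∑ i, t i ^ 2) := hcs
    _ = (matNorm A * ‖t‖ ^ 2) ^ 2 := by
        rw [matNorm, mul_pow, Real.sq_sqrt (by positivity), EuclideanSpace.real_norm_sq_eq, sq]

lemma integrable_quadForm {α : Type*} [MeasurableSpace α] {μ : Measure α}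
    {A : α → Matrix (Fin k) (Fin k) ℝ} (hA : ∀ i j, Integrable (fun a => A a i j) μ) (t : RVec k) :
    Integrable (fun a => quadForm (A a) t) μ :=
  integrable_finsetSum _ fun i _ => integrable_finsetSum _ fun j _ =>
    ((hA i j).const_mul (t i)).mul_const (t j)

lemma integral_quadForm {α : Type*} [MeasurableSpace α] {μ : Measure α}
    {A : α → Matrix (Fin k) (Fin k) ℝ} (hA : ∀ i j, Integrable (fun a => A a i j) μ) (t : RVec k) :
    ∫ a, quadForm (A a) t ∂μ = quadForm (Matrix.of fun i j => ∫ a, A a i j ∂μ) t := by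
  have hterm (i j : Fin k) : Integrable (fun a => t i * A a i j * t j) μ :=
    ((hA i j).const_mul (t i)).mul_const (t j)
  unfold quadForm
  rw [integral_finsetSum _ fun i _ => integrable_finsetSum _ fun j _ => hterm i j]
  refine Finset.sum_congr rfl fun i _ => ?_
  rw [integral_finsetSum _ fun j _ => hterm i j]
  simp only [integral_mul_const, integral_const_mul, Matrix.of_apply]

lemma quadForm_eq_dotProduct (A : Matrix (Fin k) (Fin k) ℝ) (t : RVec k) :
    quadForm A t = t.ofLp ⬝ᵥ A.mulVec t.ofLp := by
  simp only [quadForm, dotProduct, Matrix.mulVec, Finset.mul_sum, mul_assoc]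

lemma exists_unique_min_quadForm_add_inner {Γ : Matrix (Fin k) (Fin k) ℝ} (hΓ : Γ.PosDef)
    (β : RVec k) : ∃ x : RVec k, ∀ t, t ≠ x →
      1 / 2 * quadForm Γ x + inner ℝ β x < 1 / 2 * quadForm Γ t + inner ℝ β t := by
  refine ⟨WithLp.toLp 2 (-(Γ⁻¹.mulVec β.ofLp)), fun t ht => ?_⟩
  set x : Fin k → ℝ := -(Γ⁻¹.mulVec β.ofLp)
  have hΓx : Γ.mulVec x = -β.ofLp := by
    rw [Matrix.mulVec_neg, Matrix.mulVec_mulVec,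
      Matrix.mul_nonsing_inv _ ((Matrix.isUnit_iff_isUnit_det _).1 hΓ.isUnit), Matrix.one_mulVec]
  have hpos := hΓ.dotProduct_mulVec_pos (x := t.ofLp - x) fun h => ht (by rw [← sub_eq_zero.1 h])
  have hsymm : x ⬝ᵥ Γ.mulVec t.ofLp = t.ofLp ⬝ᵥ Γ.mulVec x := by
    have hΓT : Γ.transpose = Γ := by simpa using hΓ.isHermitian.eq
    rw [Matrix.dotProduct_mulVec, ← Matrix.mulVec_transpose, dotProduct_comm, hΓT]
  have hinner (y : RVec k) : (inner ℝ β y : ℝ) = y.ofLp ⬝ᵥ β.ofLp := by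
    rw [EuclideanSpace.inner_eq_star_dotProduct, star_trivial]
  simp only [star_trivial, Matrix.mulVec_sub, sub_dotProduct, dotProduct_sub, hsymm, hΓx,
    dotProduct_neg] at hpos
  simp only [quadForm_eq_dotProduct, hinner, hΓx, dotProduct_neg]
  linarith

end QuadForm

/-! ### Second-order bias of averages over a symmetric measure -/

section Taylor

variable {V F : Type*} [NormedAddCommGroup V] [NormedSpace ℝ V] [NormedAddCommGroup F]
  [NormedSpace ℝ F] {g : V → F}

lemma norm_add_sub_sub_fderiv_le (hg : ContDiff ℝ 2 g) {B : ℝ}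
    (hB : ∀ v, ‖iteratedFDeriv ℝ 2 g v‖ ≤ B) (a u : V) :
    ‖g (a + u) - g a - fderiv ℝ g a u‖ ≤ B * ‖u‖ ^ 2 := by
  have hderiv : Differentiable ℝ (fderiv ℝ g) :=
    (hg.fderiv_right (m := 1) (by norm_num)).differentiable one_ne_zero
  have hlip (v : V) : ‖fderiv ℝ g v - fderiv ℝ g a‖ ≤ B * ‖v - a‖ := by
    refine convex_univ.norm_image_sub_le_of_norm_fderiv_le (fun v _ => hderiv v) (fun v _ => ?_)
      trivial trivial
    rw [← norm_iteratedFDeriv_one, norm_iteratedFDeriv_fderiv]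
    exact hB v
  have hball : ∀ v ∈ Metric.closedBall a ‖u‖, ‖fderiv ℝ g v - fderiv ℝ g a‖ ≤ B * ‖u‖ :=
    fun v hv => (hlip v).trans (mul_le_mul_of_nonneg_left (mem_closedBall_iff_norm.1 hv)
      ((norm_nonneg _).trans (hB a)))
  have := (convex_closedBall a ‖u‖).norm_image_sub_le_of_norm_fderiv_le' (y := a + u)
    (fun v _ => hg.differentiable two_ne_zero v) hball (Metric.mem_closedBall_self (norm_nonneg u))
    (by simp)
  simpa only [add_sub_cancel_left, mul_assoc, sq] using this

lemma norm_add_smul_sub_sub_fderiv_le (hg : ContDiff ℝ 2 g) {B : ℝ}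
    (hB : ∀ v, ‖iteratedFDeriv ℝ 2 g v‖ ≤ B) (a u : V) (h : ℝ) :
    ‖g (a + h • u) - g a - fderiv ℝ g a (h • u)‖ ≤ h ^ 2 * (B * ‖u‖ ^ 2) := by
  convert norm_add_sub_sub_fderiv_le hg hB a (h • u) using 1
  rw [norm_smul, mul_pow, Real.norm_eq_abs, sq_abs]
  ring

lemma tendsto_second_order_quotient (hg : ContDiff ℝ 2 g) (a u : V) :
    Tendsto (fun h : ℝ => (h ^ 2)⁻¹ • (g (a + h • u) - g a - fderiv ℝ g a (h • u))) (𝓝[>] 0)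
      (𝓝 ((1 / 2 : ℝ) • iteratedFDeriv ℝ 2 g a fun _ => u)) := by
  have hderiv : Differentiable ℝ (fderiv ℝ g) :=
    (hg.fderiv_right (m := 1) (by norm_num)).differentiable one_ne_zero
  have htaylor := convex_univ.taylor_approx_two_segment (v := 0) (w := u)
    (fun v _ => (hg.differentiable two_ne_zero v).hasFDerivAt) (Set.mem_univ a)
    (hderiv a).hasFDerivAt.hasFDerivWithinAt (by simp) (by simp)
  have hzero := htaylor.tendsto_inv_smul_nhds_zero.add_const
    ((1 / 2 : ℝ) • fderiv ℝ (fderiv ℝ g) a u u)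
  rw [iteratedFDeriv_two_apply]
  rw [zero_add] at hzero
  refine hzero.congr' ?_
  filter_upwards [self_mem_nhdsWithin] with h (hh : 0 < h)
  simp only [smul_zero, add_zero, map_zero, zero_apply, sub_zero, map_smul]
  rw [smul_sub _ _ ((h ^ 2 / 2) • _), smul_smul, show (h ^ 2)⁻¹ * (h ^ 2 / 2) = 1 / 2 by field_simp,
    sub_add_cancel]

end Taylor

section SmoothingBias

variable {V F : Type*} [NormedAddCommGroup V] [NormedSpace ℝ V] [MeasurableSpace V] [BorelSpace V]
  [SecondCountableTopology V] [NormedAddCommGroup F] [NormedSpace ℝ F] [CompleteSpace F]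
  {ν : Measure V} [IsProbabilityMeasure ν] [ν.IsNegInvariant] {g : V → F} {B : ℝ}

lemma integral_comp_sub_smul_sub (hν : Integrable (fun u => ‖u‖ ^ 2) ν) (hg : ContDiff ℝ 2 g)
    (hB : ∀ v, ‖iteratedFDeriv ℝ 2 g v‖ ≤ B) (a : V) (h : ℝ) :
    ∫ u, g (a - h • u) ∂ν - g a = ∫ u, (g (a + h • u) - g a - fderiv ℝ g a (h • u)) ∂ν := by
  have hsymm : ∫ u, g (a - h • u) ∂ν = ∫ u, g (a + h • u) ∂ν := by
    simpa [sub_eq_add_neg] using integral_neg_eq_self (fun u => g (a + h • u)) ν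
  have hid : Integrable (fun u : V => u) ν :=
    ((memLp_two_iff_integrable_sq_norm aestronglyMeasurable_id).2 hν).integrable one_le_two
  have hlin : Integrable (fun u => fderiv ℝ g a (h • u)) ν :=
    (fderiv ℝ g a).integrable_comp (hid.smul h)
  have hlin_zero : ∫ u, fderiv ℝ g a (h • u) ∂ν = 0 := by
    have hneg := integral_neg_eq_self (fun u => fderiv ℝ g a (h • u)) ν
    simp only [smul_neg, map_neg, integral_neg] at hneg
    have : IsAddTorsionFree F := .of_isTorsionFree ℝ F
    exact self_eq_neg.1 hneg.symm
  have hrem : Integrable (fun u => g (a + h • u) - g a - fderiv ℝ g a (h • u)) ν :=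
    ((hν.const_mul B).const_mul (h ^ 2)).mono' (by fun_prop) <|
      .of_forall fun u => norm_add_smul_sub_sub_fderiv_le hg hB a u h
  have hgi : Integrable (fun u => g (a + h • u) - g a) ν :=
    (hrem.add hlin).congr (.of_forall fun u => sub_add_cancel _ _)
  have hga : Integrable (fun u => g (a + h • u)) ν :=
    (hgi.add (integrable_const (g a))).congr (.of_forall fun u => sub_add_cancel _ _)
  rw [hsymm, integral_sub hgi hlin, hlin_zero, sub_zero, integral_sub hga (integrable_const _),
    integral_const, probReal_univ, one_smul]

lemma norm_integral_comp_sub_smul_sub_le (hν : Integrable (fun u => ‖u‖ ^ 2) ν)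
    (hg : ContDiff ℝ 2 g) (hB : ∀ v, ‖iteratedFDeriv ℝ 2 g v‖ ≤ B) (a : V) (h : ℝ) :
    ‖∫ u, g (a - h • u) ∂ν - g a‖ ≤ h ^ 2 * (B * ∫ u, ‖u‖ ^ 2 ∂ν) := by
  rw [integral_comp_sub_smul_sub hν hg hB, ← integral_const_mul, ← integral_const_mul]
  exact norm_integral_le_of_norm_le ((hν.const_mul B).const_mul (h ^ 2)) <|
    .of_forall fun u => norm_add_smul_sub_sub_fderiv_le hg hB a u h

lemma tendsto_integral_comp_sub_smul_sub (hν : Integrable (fun u => ‖u‖ ^ 2) ν)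
    (hg : ContDiff ℝ 2 g) (hB : ∀ v, ‖iteratedFDeriv ℝ 2 g v‖ ≤ B) (a : V) :
    Tendsto (fun h : ℝ => (h ^ 2)⁻¹ • (∫ u, g (a - h • u) ∂ν - g a)) (𝓝[>] 0)
      (𝓝 (∫ u, (1 / 2 : ℝ) • iteratedFDeriv ℝ 2 g a (fun _ => u) ∂ν)) := by
  simp only [integral_comp_sub_smul_sub hν hg hB, ← integral_smul]
  have hcont := hg.continuous
  refine tendsto_integral_filter_of_dominated_convergence (fun u => B * ‖u‖ ^ 2)
    (.of_forall fun h => by fun_prop) ?_ (hν.const_mul B)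
    (.of_forall fun u => tendsto_second_order_quotient hg a u)
  filter_upwards [self_mem_nhdsWithin] with h (hh : 0 < h)
  refine .of_forall fun u => ?_
  rw [norm_smul, norm_inv, Real.norm_of_nonneg (sq_nonneg h), inv_mul_le_iff₀ (by positivity)]
  exact norm_add_smul_sub_sub_fderiv_le hg hB a u h

lemma tendsto_integral_integral_comp_sub_smul_sub {μ : Measure V} {ψ : V → V → F}
    {G : V → ℝ} (hν : Integrable (fun u => ‖u‖ ^ 2) ν) (hmeas : StronglyMeasurable ψ.uncurry)
    (hψ : ∀ᵐ a ∂μ, ContDiff ℝ 2 (ψ a)) (hG : Integrable G μ)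
    (hbound : ∀ᵐ a ∂μ, ∀ v, ‖iteratedFDeriv ℝ 2 (ψ a) v‖ ≤ G a)
    (hdiag : Integrable (fun a => ψ a a) μ) :
    Tendsto (fun h : ℝ => (h ^ 2)⁻¹ • (∫ a, ∫ u, ψ a (a - h • u) ∂ν ∂μ - ∫ a, ψ a a ∂μ)) (𝓝[>] 0)
      (𝓝 (∫ a, ∫ u, (1 / 2 : ℝ) • iteratedFDeriv ℝ 2 (ψ a) a (fun _ => u) ∂ν ∂μ)) := by
  have hmeas_avg (h : ℝ) : AEStronglyMeasurable (fun a => ∫ u, ψ a (a - h • u) ∂ν) μ := by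
    have hcomp : StronglyMeasurable (Function.uncurry fun a u => ψ a (a - h • u)) :=
      hmeas.comp_measurable (g := fun p : V × V => (p.1, p.1 - h • p.2)) (by fun_prop)
    exact hcomp.integral_prod_right.aestronglyMeasurable
  have hdev (h : ℝ) : ∀ᵐ a ∂μ,
      ‖∫ u, ψ a (a - h • u) ∂ν - ψ a a‖ ≤ h ^ 2 * (G a * ∫ u, ‖u‖ ^ 2 ∂ν) := by
    filter_upwards [hψ, hbound] with a ha hB
    exact norm_integral_comp_sub_smul_sub_le hν ha hB a h
  have hdev_int (h : ℝ) : Integrable (fun a => ∫ u, ψ a (a - h • u) ∂ν - ψ a a) μ :=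
    ((hG.mul_const _).const_mul (h ^ 2)).mono' ((hmeas_avg h).sub hdiag.1) (hdev h)
  have havg_int (h : ℝ) : Integrable (fun a => ∫ u, ψ a (a - h • u) ∂ν) μ :=
    ((hdev_int h).add hdiag).congr (.of_forall fun a => sub_add_cancel _ _)
  simp only [← integral_sub (havg_int _) hdiag, ← integral_smul]
  refine tendsto_integral_filter_of_dominated_convergence (fun a => G a * ∫ u, ‖u‖ ^ 2 ∂ν)
    (.of_forall fun h => (hdev_int h).1.const_smul _) ?_ (hG.mul_const _) ?_
  · filter_upwards [self_mem_nhdsWithin] with h (hh : 0 < h)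
    filter_upwards [hdev h] with a ha
    rwa [norm_smul, norm_inv, Real.norm_of_nonneg (sq_nonneg h), inv_mul_le_iff₀ (by positivity)]
  · filter_upwards [hψ, hbound] with a ha hB
    exact tendsto_integral_comp_sub_smul_sub hν ha hB a

end SmoothingBias

lemma norm_iteratedFDeriv_le_sum_partialDeriv {d k n : ℕ} (g : RVec d → RVec k) (v : RVec d) :
    ‖iteratedFDeriv ℝ n g v‖ ≤ ∑ i : Fin n → Fin d, ‖partialDeriv i g v‖ := by
  refine ContinuousMultilinearMap.opNorm_le_bound (Finset.sum_nonneg fun i _ => norm_nonneg _)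
    fun u => ?_
  have hcoord (x : RVec d) : x = ∑ j, x j • EuclideanSpace.single j (1 : ℝ) := by
    simpa using ((EuclideanSpace.basisFun (Fin d) ℝ).sum_repr x).symm
  have hexpand : iteratedFDeriv ℝ n g v u
      = ∑ i : Fin n → Fin d, (∏ l, u l (i l)) • partialDeriv i g v := by
    conv_lhs => rw [funext fun l => hcoord (u l), ContinuousMultilinearMap.map_sum]
    simp only [ContinuousMultilinearMap.map_smul_univ, partialDeriv]
  rw [hexpand, Finset.sum_mul]
  refine norm_sum_le_of_le _ fun i _ => ?_
  rw [norm_smul, norm_prod, mul_comm]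
  gcongr
  exact PiLp.norm_apply_le _ _

/-! ### Averages over small displacements -/

lemma tendsto_sub_smul_nhdsGT {V : Type*} [NormedAddCommGroup V] [NormedSpace ℝ V] (a u : V) :
    Tendsto (fun h : ℝ => a - h • u) (𝓝[>] 0) (𝓝 a) :=
  ((by fun_prop : Continuous fun h : ℝ => a - h • u).tendsto' 0 a (by simp)).mono_left
    nhdsWithin_le_nhds

lemma tendsto_prodMk_sub_smul {V : Type*} [NormedAddCommGroup V] [NormedSpace ℝ V] {S : Set V}
    (a : V) {u : V} (hu : u ≠ 0) :
    Tendsto (fun h : ℝ => (h, a - h • u)) (𝓝[>] 0 ⊓ 𝓟 {h | a - h • u ∈ S})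
      (𝓝[>] 0 ×ˢ 𝓝[S \ {a}] a) := by
  refine (tendsto_id.mono_left inf_le_left).prodMk (tendsto_nhdsWithin_iff.2
    ⟨(tendsto_sub_smul_nhdsGT a u).mono_left inf_le_left, ?_⟩)
  filter_upwards [mem_inf_of_left self_mem_nhdsWithin, mem_inf_of_right (mem_principal_self _)]
    with h (hh : 0 < h) hS
  exact ⟨hS, by simpa [sub_eq_self] using ⟨hh.ne', hu⟩⟩

lemma tendsto_integral_of_dominated_convergence_off {α ι F : Type*} [MeasurableSpace α]
    [NormedAddCommGroup F] [NormedSpace ℝ F] {μ : Measure α} {l : Filter ι}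
    [l.IsCountablyGenerated] {φ : ι → α → F} {g : α → F} {G : α → ℝ} {T : ι → Set α}
    (hT : ∀ i, MeasurableSet (T i)) (hμT : Tendsto (fun i => μ (T i)) l (𝓝 0))
    (hφT : ∀ i, ∀ q ∈ T i, φ i q = 0) (hφ : ∀ᶠ i in l, AEStronglyMeasurable (φ i) μ)
    (hφG : ∀ᶠ i in l, ∀ᵐ q ∂μ, ‖φ i q‖ ≤ G q) (hG : Integrable G μ) (hg : Integrable g μ)
    (hlim : ∀ᵐ q ∂μ, Tendsto (fun i => φ i q) (l ⊓ 𝓟 {i | q ∉ T i}) (𝓝 (g q))) :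
    Tendsto (fun i => ∫ q, φ i q ∂μ) l (𝓝 (∫ q, g q ∂μ)) := by
  have hcorrected : Tendsto (fun i => ∫ q, (φ i q + (T i).indicator g q) ∂μ) l
      (𝓝 (∫ q, g q ∂μ)) := by
    refine tendsto_integral_filter_of_dominated_convergence (fun q => G q + ‖g q‖) ?_ ?_
      (hG.add hg.norm) ?_
    · filter_upwards [hφ] with i hi using hi.add (hg.1.indicator (hT i))
    · filter_upwards [hφG] with i hi
      filter_upwards [hi] with q hq using norm_add_le_of_le hq (norm_indicator_le_norm_self _ _)
    · filter_upwards [hlim] with q hq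
      classical
      refine (hq.if (p := fun i => q ∉ T i) (g := fun _ => g q) tendsto_const_nhds).congr
        fun i => ?_
      by_cases hqT : q ∈ T i
      · rw [if_neg (not_not.2 hqT), hφT i q hqT, Set.indicator_of_mem hqT, zero_add]
      · rw [if_pos hqT, Set.indicator_of_notMem hqT, add_zero]
  have hdiff := hcorrected.sub (hg.tendsto_setIntegral_nhds_zero hμT)
  rw [sub_zero] at hdiff
  refine hdiff.congr' ?_
  filter_upwards [hφ, hφG] with i hm hb
  rw [← integral_indicator (hT i), integral_add (hG.mono' hm hb) (hg.indicator (hT i)),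
    add_sub_cancel_right]

section Displacement

variable {V : Type*} [NormedAddCommGroup V] [NormedSpace ℝ V] [FiniteDimensional ℝ V]
  [MeasurableSpace V] [BorelSpace V] {μ W ν : Measure V} [μ.IsAddHaarMeasure] [IsFiniteMeasure W]
  {S : Set V}

lemma tendsto_measure_symmDiff_preimage_sub {s : Set V} (hs : MeasurableSet s) (hμs : μ s ≠ ∞) :
    Tendsto (fun v : V => μ (symmDiff ((fun a => a - v) ⁻¹' s) s)) (𝓝 0) (𝓝 0) := by
  let shift : C(V, C(V, V)) := ContinuousMap.curry ⟨fun p : V × V => p.2 - p.1, by fun_prop⟩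
  have hshift : Tendsto shift (𝓝 0) (𝓝 (ContinuousMap.id V)) := by
    convert shift.continuous.tendsto 0
    ext a
    exact (sub_zero a).symm
  exact tendsto_measure_symmDiff_preimage_nhds_zero (μ := μ) (ν := μ) (f := shift)
    (g := ContinuousMap.id V) hshift (.of_forall fun v => measurePreserving_sub_right μ v)
    (MeasurePreserving.id μ) hs.nullMeasurableSet hμs

lemma tendsto_measure_inter_sub_notMem (hW : W ≪ μ) (hS : MeasurableSet S) :
    Tendsto (fun v : V => W {a | a ∈ S ∧ a - v ∉ S}) (𝓝 0) (𝓝 0) := by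
  refine ENNReal.tendsto_nhds_zero.2 fun ε hε => ?_
  obtain ⟨C, hCS, hC, hSC⟩ :=
    hS.exists_isCompact_sdiff_lt (measure_ne_top W S) (ENNReal.half_pos hε.ne').ne'
  have hsymm : Tendsto (fun v : V => W (symmDiff ((fun a => a - v) ⁻¹' C) C)) (𝓝 0) (𝓝 0) := by
    simpa only [Measure.setLIntegral_rnDeriv hW] using
      tendsto_setLIntegral_zero (Measure.lintegral_rnDeriv_lt_top W μ).ne
        (tendsto_measure_symmDiff_preimage_sub (μ := μ) hC.measurableSet hC.measure_lt_top.ne)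
  filter_upwards [ENNReal.tendsto_nhds_zero.1 hsymm (ε / 2) (ENNReal.half_pos hε.ne')] with v hv
  calc W {a | a ∈ S ∧ a - v ∉ S}
      ≤ W (S \ C ∪ symmDiff ((fun a => a - v) ⁻¹' C) C) := measure_mono fun a ⟨ha, hav⟩ => by
        by_cases haC : a ∈ C
        · exact .inr (.inr ⟨haC, fun h => hav (hCS h)⟩)
        · exact .inl ⟨ha, haC⟩
    _ ≤ ε / 2 + ε / 2 := (measure_union_le _ _).trans (add_le_add hSC.le hv)
    _ = ε := ENNReal.add_halves ε

lemma tendsto_prod_measure_sub_smul_notMem [IsFiniteMeasure ν] (hW : W ≪ μ)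
    (hS : MeasurableSet S) (hWS : ∀ᵐ a ∂W, a ∈ S) :
    Tendsto (fun h : ℝ => (W.prod ν) {q | q.1 - h • q.2 ∉ S}) (𝓝[>] 0) (𝓝 0) := by
  have hmeas (h : ℝ) : MeasurableSet {q : V × V | q.1 - h • q.2 ∉ S} :=
    (hS.preimage (f := fun q : V × V => q.1 - h • q.2) (by fun_prop)).compl
  simp only [Measure.prod_apply_symm (hmeas _)]
  rw [← lintegral_zero (μ := ν)]
  refine tendsto_lintegral_filter_of_dominated_convergence (fun _ => W Set.univ)
    (.of_forall fun h => measurable_measure_prodMk_right (hmeas h))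
    (.of_forall fun h => .of_forall fun u => measure_mono (Set.subset_univ _))
    (by simpa using ENNReal.mul_ne_top (measure_ne_top W _) (measure_ne_top ν _))
    (.of_forall fun u => ?_)
  have hzero : Tendsto (fun h : ℝ => h • u) (𝓝[>] 0) (𝓝 0) := by
    simpa using (tendsto_sub_smul_nhdsGT 0 u).neg
  refine ((tendsto_measure_inter_sub_notMem hW hS).comp hzero).congr fun h =>
    measure_congr ?_
  filter_upwards [hWS] with a ha
  exact propext (and_iff_right ha)

theorem tendsto_integral_integral_sub_smul {F : Type*} [NormedAddCommGroup F] [NormedSpace ℝ F]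
    [IsProbabilityMeasure ν] (hν : ν {0} = 0) (hW : W ≪ μ)
    (hS : MeasurableSet S) (hWS : ∀ᵐ a ∂W, a ∈ S) {φ : ℝ → V → V → F} {G : V → ℝ} {g : V → F}
    (hφ : ∀ᶠ h in 𝓝[>] (0 : ℝ), StronglyMeasurable (φ h).uncurry)
    (hφS : ∀ h a, ∀ v ∉ S, φ h a v = 0) (hG : Integrable G W) (hg : Integrable g W)
    (hφG : ∀ᶠ h in 𝓝[>] (0 : ℝ), ∀ᵐ a ∂W, ∀ v ∈ S, ‖φ h a v‖ ≤ G a)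
    (hlim : ∀ᵐ a ∂W, Tendsto (fun p : ℝ × V => φ p.1 a p.2) (𝓝[>] 0 ×ˢ 𝓝[S \ {a}] a)
      (𝓝 (g a))) :
    Tendsto (fun h : ℝ => ∫ a, ∫ u, φ h a (a - h • u) ∂ν ∂W) (𝓝[>] 0) (𝓝 (∫ a, g a ∂W)) := by
  have hmeas : ∀ᶠ h in 𝓝[>] (0 : ℝ), StronglyMeasurable fun q : V × V => φ h q.1 (q.1 - h • q.2) :=
    hφ.mono fun h hh =>
      hh.comp_measurable (g := fun q : V × V => (q.1, q.1 - h • q.2)) (by fun_prop)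
  have hbound : ∀ᶠ h in 𝓝[>] (0 : ℝ), ∀ᵐ q ∂W.prod ν, ‖φ h q.1 (q.1 - h • q.2)‖ ≤ ‖G q.1‖ := by
    filter_upwards [hφG] with h hh
    filter_upwards [Measure.quasiMeasurePreserving_fst.ae hh] with q hq
    by_cases hqS : q.1 - h • q.2 ∈ S
    · exact (hq _ hqS).trans (le_abs_self _)
    · simp [hφS h _ _ hqS]
  have hG₁ : Integrable (fun q : V × V => ‖G q.1‖) (W.prod ν) := hG.norm.comp_fst ν
  have hpointwise : ∀ᵐ q ∂W.prod ν, Tendsto (fun h : ℝ => φ h q.1 (q.1 - h • q.2))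
      (𝓝[>] 0 ⊓ 𝓟 {h | ¬(q.1 - h • q.2 ∉ S)}) (𝓝 (g q.1)) := by
    have hne : ∀ᵐ u ∂ν, u ≠ 0 := by simpa [ae_iff] using hν
    filter_upwards [Measure.quasiMeasurePreserving_fst.ae hlim,
      Measure.quasiMeasurePreserving_snd.ae hne] with q hq hq0
    simp only [not_not]
    exact hq.comp (tendsto_prodMk_sub_smul q.1 hq0)
  have hprod := tendsto_integral_of_dominated_convergence_off
    (fun h => (hS.preimage (f := fun q : V × V => q.1 - h • q.2) (by fun_prop)).compl)
    (tendsto_prod_measure_sub_smul_notMem hW hS hWS) (fun h q hq => hφS h _ _ hq)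
    (hmeas.mono fun h hh => hh.aestronglyMeasurable) hbound hG₁ (hg.comp_fst ν) hpointwise
  rw [integral_fun_fst, probReal_univ, one_smul] at hprod
  refine hprod.congr' ?_
  filter_upwards [hmeas, hbound] with h hm hb
  exact integral_prod _ (hG₁.mono' hm.aestronglyMeasurable hb)

end Displacement

/-! ### Disintegration of the smoothed pair law -/

section

variable {α β γ δ : Type*} [MeasurableSpace α] [MeasurableSpace β] [MeasurableSpace γ]
  [MeasurableSpace δ]

lemma lintegral_compProd_prod_compProd (μ : Measure α) [SFinite μ] (ν : Measure β) [SFinite ν]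
    (κ : Kernel α γ) [IsSFiniteKernel κ] (η : Kernel β δ) [IsSFiniteKernel η]
    {φ : (α × γ) × (β × δ) → ℝ≥0∞} (hφ : Measurable φ) :
    ∫⁻ p, φ p ∂(μ ⊗ₘ κ).prod (ν ⊗ₘ η)
      = ∫⁻ a, ∫⁻ b, ∫⁻ q, φ ((a, q.1), (b, q.2)) ∂(κ a).prod (η b) ∂ν ∂μ := by
  have hinner : Measurable fun r : (α × γ) × β => ∫⁻ y, φ (r.1, (r.2, y)) ∂η r.2 :=
    Measurable.lintegral_kernel_prod_right' (κ := η.comap Prod.snd measurable_snd)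
      (f := fun s : ((α × γ) × β) × δ => φ (s.1.1, (s.1.2, s.2))) (by fun_prop)
  calc ∫⁻ p, φ p ∂(μ ⊗ₘ κ).prod (ν ⊗ₘ η)
      = ∫⁻ p, ∫⁻ b, ∫⁻ y, φ (p, (b, y)) ∂η b ∂ν ∂(μ ⊗ₘ κ) := by
        rw [lintegral_prod _ hφ.aemeasurable]
        exact lintegral_congr fun p => Measure.lintegral_compProd (by fun_prop)
    _ = ∫⁻ a, ∫⁻ x, ∫⁻ b, ∫⁻ y, φ ((a, x), (b, y)) ∂η b ∂ν ∂κ a ∂μ :=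
        Measure.lintegral_compProd hinner.lintegral_prod_right'
    _ = ∫⁻ a, ∫⁻ b, ∫⁻ x, ∫⁻ y, φ ((a, x), (b, y)) ∂η b ∂κ a ∂ν ∂μ := lintegral_congr fun a =>
        lintegral_lintegral_swap
          (hinner.comp (g := fun r : (α × γ) × β => _)
            (f := fun q : γ × β => ((a, q.1), q.2)) (by fun_prop)).aemeasurable
    _ = ∫⁻ a, ∫⁻ b, ∫⁻ q, φ ((a, q.1), (b, q.2)) ∂(κ a).prod (η b) ∂ν ∂μ := by
        refine lintegral_congr fun a => lintegral_congr fun b => ?_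
        rw [lintegral_prod _ (by fun_prop)]

lemma map_prodProdProdComm_compProd_prod (μ : Measure α) [SFinite μ] (ν : Measure β) [SFinite ν]
    (κ : Kernel α γ) [IsSFiniteKernel κ] (η : Kernel β δ) [IsSFiniteKernel η] :
    ((μ ⊗ₘ κ).prod (ν ⊗ₘ η)).map (fun p => ((p.1.1, p.2.1), (p.1.2, p.2.2)))
      = (μ.prod ν) ⊗ₘ (κ ∥ₖ η) := by
  refine Measure.ext_of_lintegral _ fun φ hφ => ?_
  rw [lintegral_map hφ (by fun_prop), lintegral_compProd_prod_compProd μ ν κ η (by fun_prop),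
    Measure.lintegral_compProd hφ, lintegral_prod _ hφ.lintegral_kernel_prod_right'.aemeasurable]
  simp only [Kernel.parallelComp_apply]

end

/-- The measure with Lebesgue density `K`, with respect to which the kernel averages are taken. -/
def kernelLaw {d : ℕ} (K : RVec d → ℝ) : Measure (RVec d) :=
  volume.withDensity fun u => ENNReal.ofReal (K u)

/-- The rescaled kernel `K_h(u) = h⁻ᵈ K(u / h)`. -/
def scaledKernel {d : ℕ} (K : RVec d → ℝ) (h : ℝ) (u : RVec d) : ℝ :=
  (h ^ d)⁻¹ * K (h⁻¹ • u)

/-- A second-order kernel: a symmetric, bounded probability density with finite second moment. -/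
structure IsSecondOrderKernel {d : ℕ} (K : RVec d → ℝ) : Prop where
  symm : ∀ u, K (-u) = K u
  bounded : ∃ C : ℝ, ∀ u, K u ≤ C
  nonneg : ∀ u, 0 ≤ K u
  measurable : Measurable K
  lintegral_eq_one : ∫⁻ u, ENNReal.ofReal (K u) = 1
  lintegral_norm_sq_mul_lt_top : ∫⁻ u, ENNReal.ofReal (‖u‖ ^ 2 * K u) < ∞

section Kernel

variable {d : ℕ} {K : RVec d → ℝ} {E : Type*} [NormedAddCommGroup E] [NormedSpace ℝ E]

lemma kernelLaw_singleton (hd : 0 < d) (a : RVec d) : kernelLaw K {a} = 0 :=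
  have : Nonempty (Fin d) := ⟨⟨0, hd⟩⟩
  withDensity_absolutelyContinuous _ _ (measure_singleton a)

lemma integral_kernelLaw (hm : Measurable K) (h0 : ∀ u, 0 ≤ K u) (g : RVec d → E) :
    ∫ u, g u ∂kernelLaw K = ∫ u, K u • g u := by
  rw [kernelLaw, integral_withDensity_eq_integral_toReal_smul (by fun_prop) (by simp)]
  simp only [ENNReal.toReal_ofReal (h0 _)]

namespace IsSecondOrderKernel

lemma isProbabilityMeasure (hK : IsSecondOrderKernel K) : IsProbabilityMeasure (kernelLaw K) :=
  ⟨by rw [kernelLaw, withDensity_apply _ .univ, Measure.restrict_univ, hK.lintegral_eq_one]⟩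

lemma isNegInvariant (hK : IsSecondOrderKernel K) : (kernelLaw K).IsNegInvariant := by
  have hm := hK.measurable
  refine ⟨Measure.ext_of_lintegral _ fun φ hφ => ?_⟩
  rw [Measure.neg, lintegral_map hφ measurable_neg, kernelLaw,
    lintegral_withDensity_eq_lintegral_mul _ (by fun_prop) (by fun_prop),
    lintegral_withDensity_eq_lintegral_mul _ (by fun_prop) (by fun_prop),
    ← lintegral_neg_eq_self (μ := volume) ((fun u => ENNReal.ofReal (K u)) * φ)]
  simp only [Pi.mul_apply, hK.symm]

lemma integrable_norm_sq (hK : IsSecondOrderKernel K) :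
    Integrable (fun u => ‖u‖ ^ 2) (kernelLaw K) := by
  have hm := hK.measurable
  rw [kernelLaw, integrable_withDensity_iff (by fun_prop) (by simp)]
  simp only [ENNReal.toReal_ofReal (hK.nonneg _)]
  exact ⟨by fun_prop, (hasFiniteIntegral_iff_ofReal (.of_forall fun u =>
    mul_nonneg (sq_nonneg _) (hK.nonneg u))).2 hK.lintegral_norm_sq_mul_lt_top⟩

lemma measurable_scaledKernel (hK : IsSecondOrderKernel K) (h : ℝ) :
    Measurable (scaledKernel K h) := by
  have hm := hK.measurable
  unfold scaledKernel
  fun_prop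

lemma scaledKernel_nonneg (hK : IsSecondOrderKernel K) {h : ℝ} (hh : 0 ≤ h) (u : RVec d) :
    0 ≤ scaledKernel K h u :=
  mul_nonneg (by positivity) (hK.nonneg _)

lemma exists_norm_scaledKernel_le (hK : IsSecondOrderKernel K) {h : ℝ} (hh : 0 ≤ h) :
    ∃ C, ∀ u, ‖scaledKernel K h u‖ ≤ C := by
  obtain ⟨C, hC⟩ := hK.bounded
  refine ⟨(h ^ d)⁻¹ * C, fun u => ?_⟩
  rw [Real.norm_of_nonneg (hK.scaledKernel_nonneg hh u)]
  exact mul_le_mul_of_nonneg_left (hC _) (by positivity)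

end IsSecondOrderKernel

lemma integral_scaledKernel_sub_smul {h : ℝ} (hh : 0 < h) (a : RVec d) (g : RVec d → E) :
    ∫ v, scaledKernel K h (a - v) • g v = ∫ u, K u • g (a - h • u) := by
  have hpos : 0 < (h ^ d)⁻¹ := by positivity
  have hscale := Measure.integral_comp_smul volume (fun v => scaledKernel K h v • g (a - v)) h
  simp only [scaledKernel, inv_smul_smul₀ hh.ne', mul_smul, integral_smul,
    finrank_euclideanSpace_fin, abs_of_pos hpos] at hscale
  rw [← integral_sub_left_eq_self _ volume a]
  simp only [sub_sub_cancel, scaledKernel, mul_smul, integral_smul]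
  exact (smul_right_injective E hpos.ne' hscale).symm

end Kernel

namespace Population

variable {d k : ℕ} {Z : Type*} [MeasurableSpace Z] (D : Population d Z)
  {E : Type*} [NormedAddCommGroup E] [NormedSpace ℝ E] {g : Z → Z → E}

instance : IsProbabilityMeasure D.P := D.isProbabilityMeasure

instance : IsMarkovKernel D.κ := D.isMarkovKernel

instance : IsProbabilityMeasure D.lawW :=
  Measure.isProbabilityMeasure_map D.measurable_w.aemeasurable

lemma lawW_absolutelyContinuous : D.lawW ≪ volume := by
  rw [lawW, D.law_w]
  exact withDensity_absolutelyContinuous _ _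

lemma integral_lawW (g : RVec d → E) : ∫ v, g v ∂D.lawW = ∫ v, D.f v • g v := by
  have hf := D.measurable_f
  rw [lawW, D.law_w, integral_withDensity_eq_integral_toReal_smul (by fun_prop) (by simp)]
  simp only [ENNReal.toReal_ofReal (D.f_nonneg _)]

lemma integrable_lawW_iff {g : RVec d → E} :
    Integrable g D.lawW ↔ Integrable (fun v => D.f v • g v) := by
  have hf := D.measurable_f
  rw [lawW, D.law_w, integrable_withDensity_iff_integrable_smul' (by fun_prop) (by simp)]
  simp only [ENNReal.toReal_ofReal (D.f_nonneg _)]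

lemma ae_mem_supp : ∀ᵐ a ∂D.lawW, a ∈ D.supp := Measure.support_mem_ae

lemma isClosed_supp : IsClosed D.supp := Measure.isClosed_support

lemma f_eq_zero_of_notMem_supp {a : RVec d} (ha : a ∉ D.supp) : D.f a = 0 := D.f_eq_zero a ha

lemma M₀_eq_integral_lawW (m : Z → Z → RVec k → ℝ) (θ : RVec k) :
    D.M₀ m θ = ∫ a, D.f a * D.condPair (fun x y => m x y θ) a a ∂D.lawW := by
  unfold M₀ M₀Integrand
  rw [integral_lawW, setIntegral_eq_integral_of_forall_compl_eq_zero fun a ha => by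
    simp [D.f_eq_zero_of_notMem_supp ha]]
  exact integral_congr_ae (.of_forall fun a => by simp only [smul_eq_mul]; ring)

lemma measurePreserving_pairLaw :
    MeasurePreserving (fun p => ((D.w p.1, D.w p.2), p)) D.pairLaw
      ((D.lawW.prod D.lawW) ⊗ₘ (D.κ ∥ₖ D.κ)) := by
  have hw := D.measurable_w
  have hgraph : MeasurePreserving (fun z => (D.w z, z)) D.P (D.lawW ⊗ₘ D.κ) :=
    ⟨by fun_prop, D.disintegration⟩
  exact MeasurePreserving.comp
    ⟨by fun_prop, map_prodProdProdComm_compProd_prod D.lawW D.lawW D.κ D.κ⟩ (hgraph.prod hgraph)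

lemma stronglyMeasurable_condPair (hg : StronglyMeasurable fun p : Z × Z => g p.1 p.2) :
    StronglyMeasurable (Function.uncurry (D.condPair g)) := by
  have hint := StronglyMeasurable.integral_kernel (κ := D.κ ∥ₖ D.κ) hg
  simp only [Kernel.parallelComp_apply] at hint
  exact hint

lemma ae_integrable_condPairLaw {F : Type*} [NormedAddCommGroup F] {g : Z → Z → F}
    (hg : StronglyMeasurable fun p : Z × Z => g p.1 p.2)
    (hi : Integrable (fun p : Z × Z => g p.1 p.2) D.pairLaw) :
    ∀ᵐ a ∂D.lawW, ∀ᵐ v ∂D.lawW, Integrable (fun p : Z × Z => g p.1 p.2) (D.condPairLaw a v) := by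
  have hprod := ((D.measurePreserving_pairLaw.integrable_comp
    (hg.comp_measurable measurable_snd).aestronglyMeasurable).1 hi).ae_of_compProd
  simp only [Kernel.prodMkLeft_apply, Kernel.parallelComp_apply] at hprod
  exact Measure.ae_ae_of_ae_prod hprod

lemma integral_smul_pairLaw (hg : StronglyMeasurable fun p : Z × Z => g p.1 p.2)
    {c : RVec d → RVec d → ℝ} (hc : Measurable c.uncurry)
    (hi : Integrable (fun p => c (D.w p.1) (D.w p.2) • g p.1 p.2) D.pairLaw) :
    ∫ p, c (D.w p.1) (D.w p.2) • g p.1 p.2 ∂D.pairLaw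
      = ∫ a, ∫ v, c a v • D.condPair g a v ∂D.lawW ∂D.lawW := by
  have hΦ : StronglyMeasurable fun x : (RVec d × RVec d) × (Z × Z) =>
      c.uncurry x.1 • g x.2.1 x.2.2 :=
    (hc.comp measurable_fst).stronglyMeasurable.smul (hg.comp_measurable measurable_snd)
  have hpres := D.measurePreserving_pairLaw
  have hΦi := (hpres.integrable_comp hΦ.aestronglyMeasurable).1 hi
  have hcond (q : RVec d × RVec d) : ∫ p, c.uncurry q • g p.1 p.2 ∂(D.κ ∥ₖ D.κ) q
      = c q.1 q.2 • D.condPair g q.1 q.2 := by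
    rw [integral_smul, Kernel.parallelComp_apply]
    rfl
  have houter := hΦi.integral_compProd
  simp only [Kernel.prodMkLeft_apply, hcond] at houter
  calc ∫ p, c (D.w p.1) (D.w p.2) • g p.1 p.2 ∂D.pairLaw
      = ∫ x, c.uncurry x.1 • g x.2.1 x.2.2 ∂((D.lawW.prod D.lawW) ⊗ₘ (D.κ ∥ₖ D.κ)) := by
        rw [← hpres.map_eq, integral_map hpres.aemeasurable hΦ.aestronglyMeasurable]
        rfl
    _ = ∫ q, c q.1 q.2 • D.condPair g q.1 q.2 ∂(D.lawW.prod D.lawW) := by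
        rw [Measure.integral_compProd hΦi]
        simp only [hcond]
    _ = ∫ a, ∫ v, c a v • D.condPair g a v ∂D.lawW ∂D.lawW := integral_prod _ houter

lemma integrable_scaledKernel_smul {K : RVec d → ℝ} (hK : IsSecondOrderKernel K)
    (hi : Integrable (fun p : Z × Z => g p.1 p.2) D.pairLaw) {h : ℝ} (hh : 0 ≤ h) :
    Integrable (fun p => scaledKernel K h (D.w p.1 - D.w p.2) • g p.1 p.2) D.pairLaw := by
  have hw := D.measurable_w
  obtain ⟨C, hC⟩ := hK.exists_norm_scaledKernel_le hh
  exact hi.bdd_smul C ((hK.measurable_scaledKernel h).comp (by fun_prop)).aestronglyMeasurable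
    (.of_forall fun p => hC _)

theorem integral_scaledKernel_smul {K : RVec d → ℝ} (hK : IsSecondOrderKernel K)
    (hg : StronglyMeasurable fun p : Z × Z => g p.1 p.2)
    (hi : Integrable (fun p : Z × Z => g p.1 p.2) D.pairLaw) {h : ℝ} (hh : 0 < h) :
    ∫ p, scaledKernel K h (D.w p.1 - D.w p.2) • g p.1 p.2 ∂D.pairLaw
      = ∫ a, ∫ u, D.f (a - h • u) • D.condPair g a (a - h • u) ∂kernelLaw K ∂D.lawW := by
  rw [D.integral_smul_pairLaw (c := fun a v => scaledKernel K h (a - v)) hg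
    ((hK.measurable_scaledKernel h).comp (measurable_fst.sub measurable_snd))
    (D.integrable_scaledKernel_smul hK hi hh.le)]
  refine integral_congr_ae (.of_forall fun a => ?_)
  simp only [integral_lawW, smul_comm (D.f _) (scaledKernel K h _)]
  rw [integral_scaledKernel_sub_smul hh a fun v => D.f v • D.condPair g a v,
    integral_kernelLaw hK.measurable hK.nonneg]

end Population

/-! ### First-order condition -/

lemma le_of_ae_le_of_mem_support {X : Type*} [TopologicalSpace X] [HereditarilyLindelofSpace X]
    [MeasurableSpace X] {μ : Measure X} {a : X} (ha : a ∈ μ.support) {g : X → ℝ} {y B : ℝ}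
    (hg : Tendsto g (𝓝[μ.support] a) (𝓝 y)) (hB : ∀ᵐ v ∂μ, g v ≤ B) : y ≤ B := by
  have hne : (𝓝 a ⊓ ae μ).NeBot := inf_neBot_iff.2 fun {U} hU {V} hV => by
    refine nonempty_of_measure_ne_zero (μ := μ) ?_
    rw [measure_inter_conull (mem_ae_iff.1 hV)]
    exact ((Measure.mem_support_iff_forall a).1 ha U hU).ne'
  exact le_of_tendsto (hg.mono_left (inf_le_inf_left _ (le_principal_iff.2 Measure.support_mem_ae)))
    (inf_le_right (a := 𝓝 a) hB)

lemma nonneg_of_le_mul_add_sq {g : ℝ → ℝ} {b C : ℝ} (h0 : ∀ᶠ τ in 𝓝[>] (0 : ℝ), 0 ≤ g τ)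
    (hg : ∀ᶠ τ in 𝓝[>] (0 : ℝ), g τ ≤ τ * b + τ ^ 2 * C) : 0 ≤ b := by
  have hlim : Tendsto (fun τ : ℝ => b + τ * C) (𝓝[>] 0) (𝓝 b) := by
    have hcont : Continuous fun τ : ℝ => b + τ * C := by fun_prop
    simpa using (hcont.tendsto 0).mono_left nhdsWithin_le_nhds
  refine ge_of_tendsto hlim ?_
  filter_upwards [h0, hg, self_mem_nhdsWithin] with τ h0τ hgτ (hτ : 0 < τ)
  exact nonneg_of_mul_nonneg_right (by linarith : 0 ≤ τ * (b + τ * C)) hτ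

/-- The remainder of the first-order expansion of `θ ↦ E[m(z₁, z₂; θ) | w₁ = a, w₂ = v] f(v)` at
`θ₀` in the direction `t`, divided by `τ²`: the scale in which it has a limit as `τ ↓ 0`. -/
def Population.scaledRemainder {d k : ℕ} {Z : Type*} [MeasurableSpace Z] (D : Population d Z)
    (m : Z → Z → RVec k → ℝ) (s : Z → Z → RVec k → RVec k) (θ₀ t : RVec k) (τ : ℝ)
    (a v : RVec d) : ℝ :=
  D.f v * (D.condPair (remr m s t θ₀ τ) a v / τ)

/-- The criterion `m` is convex in the parameter, and its smoothing limit `M₀` is minimized over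
`Θ` at the interior point `θ₀`. The conditional mean of `m` enters `M₀` on the diagonal, a null set,
so `tendsto_diag` ties it to its values nearby. -/
structure ConvexCriterion {d k : ℕ} {Z : Type*} [MeasurableSpace Z] (D : Population d Z)
    (m : Z → Z → RVec k → ℝ) (Θ : Set (RVec k)) (θ₀ : RVec k) : Prop where
  convex : Convex ℝ Θ
  mem_nhds : Θ ∈ 𝓝 θ₀
  measurable : ∀ θ ∈ Θ, Measurable fun p : Z × Z => m p.1 p.2 θ
  integrable : ∀ θ ∈ Θ, Integrable (fun p : Z × Z => m p.1 p.2 θ) D.pairLaw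
  ae_convexOn : ∀ᵐ p ∂D.pairLaw, ConvexOn ℝ Θ (m p.1 p.2)
  tendsto_diag : ∀ θ ∈ Θ, ∀ᵐ a ∂D.lawW,
    Tendsto (fun v => D.f v * D.condPair (fun x y => m x y θ) a v) (𝓝[D.supp] a)
      (𝓝 (D.f a * D.condPair (fun x y => m x y θ) a a))
  integrableOn_M₀Integrand : ∀ θ ∈ Θ, IntegrableOn (D.M₀Integrand m θ) D.supp
  isMinOn : IsMinOn (D.M₀ m) Θ θ₀

/-- A second-order expansion at `θ₀` of `θ ↦ E[m(z₁, z₂; θ) | w₁ = a, w₂ = v] f(v)`, with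
first-order term given by `s`, dominated in `v`, and with limiting Hessian `G₀ a` as `v → a`. Being
a null set, the diagonal `v = a` is left out of the limit. -/
structure LocalExpansion {d k : ℕ} {Z : Type*} [MeasurableSpace Z] (D : Population d Z)
    (m : Z → Z → RVec k → ℝ) (s : Z → Z → RVec k → RVec k) (θ₀ : RVec k)
    (G₀ : RVec d → Matrix (Fin k) (Fin k) ℝ) : Prop where
  measurable : Measurable fun p : Z × Z => s p.1 p.2 θ₀
  integrable : Integrable (fun p : Z × Z => s p.1 p.2 θ₀) D.pairLaw
  dominated : ∀ t : RVec k, ∃ G : RVec d → ℝ, Integrable G D.lawW ∧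
    ∀ᶠ τ in 𝓝[>] (0 : ℝ), ∀ᵐ a ∂D.lawW, ∀ v ∈ D.supp, |D.scaledRemainder m s θ₀ t τ a v| ≤ G a
  tendsto : ∀ t : RVec k, ∀ᵐ a ∂D.lawW,
    Tendsto (fun p : ℝ × RVec d => D.scaledRemainder m s θ₀ t p.1 a p.2)
      (𝓝[>] 0 ×ˢ 𝓝[D.supp \ {a}] a) (𝓝 (1 / 2 * quadForm (G₀ a) t))
  integrable_hessian : ∀ i j, Integrable (fun a => G₀ a i j) D.lawW
  posDef_hessian : (Matrix.of fun i j : Fin k => ∫ a, G₀ a i j ∂D.lawW).PosDef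

section

variable {d k : ℕ} {Z : Type*} [MeasurableSpace Z] {D : Population d Z}
  {m : Z → Z → RVec k → ℝ} {Θ : Set (RVec k)} {θ₀ : RVec k} {s : Z → Z → RVec k → RVec k}

lemma FiniteMean.exists_integrable {α : Type*} [MeasurableSpace α] {μ : Measure α}
    {g : α → ℝ≥0∞} (hg : FiniteMean μ g) :
    ∃ G : α → ℝ, Integrable G μ ∧ (∀ x, 0 ≤ G x) ∧ ∀ᵐ x ∂μ, g x ≤ ENNReal.ofReal (G x) := by
  obtain ⟨G, hGm, hgG, hG⟩ := hg
  refine ⟨fun x => (G x).toReal, integrable_toReal_of_lintegral_ne_top hGm.aemeasurable hG.ne,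
    fun x => ENNReal.toReal_nonneg, ?_⟩
  filter_upwards [hgG, ae_lt_top hGm hG.ne] with x hgx hx
  rwa [ENNReal.ofReal_toReal hx.ne]

lemma Population.stronglyMeasurable_ψ (D : Population d Z)
    (hs : Measurable fun p : Z × Z => s p.1 p.2 θ₀) :
    StronglyMeasurable (Function.uncurry (D.ψ s θ₀)) :=
  (D.measurable_f.comp measurable_snd).stronglyMeasurable.smul
    (D.stronglyMeasurable_condPair (g := fun x y => s x y θ₀) hs.stronglyMeasurable)

lemma Population.iteratedFDeriv_ψ_of_notMem_supp (D : Population d Z) (n : ℕ) (a : RVec d)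
    {v : RVec d} (hv : v ∉ D.supp) : iteratedFDeriv ℝ n (D.ψ s θ₀ a) v = 0 := by
  have hzero : D.ψ s θ₀ a =ᶠ[𝓝 v] 0 := by
    filter_upwards [D.isClosed_supp.isOpen_compl.mem_nhds hv] with v' hv'
    simp [Population.ψ, D.f_eq_zero_of_notMem_supp hv']
  rw [(hzero.iteratedFDeriv ℝ n).eq_of_nhds]
  simp

lemma SmoothPsi.exists_norm_iteratedFDeriv_le (hψ : SmoothPsi D s θ₀) {n : ℕ} (hn : n ≤ 2) :
    ∃ G : RVec d → ℝ, Integrable G D.lawW ∧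
      ∀ᵐ a ∂D.lawW, ∀ v, ‖iteratedFDeriv ℝ n (D.ψ s θ₀ a) v‖ ≤ G a := by
  choose G hG hG0 hbound using fun i => (hψ.2 n hn i).exists_integrable
  refine ⟨fun a => ∑ i, G i a, integrable_finsetSum _ fun i _ => hG i, ?_⟩
  filter_upwards [ae_all_iff.2 hbound] with a ha v
  by_cases hv : v ∈ D.supp
  · refine (norm_iteratedFDeriv_le_sum_partialDeriv _ v).trans (Finset.sum_le_sum fun i _ => ?_)
    have hsup : ‖partialDeriv i (D.ψ s θ₀ a) v‖ₑ ≤ ENNReal.ofReal (G i a) :=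
      (le_iSup₂_of_le v hv le_rfl).trans (ha i)
    rwa [← ofReal_norm, ENNReal.ofReal_le_ofReal_iff (hG0 i a)] at hsup
  · rw [D.iteratedFDeriv_ψ_of_notMem_supp n a hv, norm_zero]
    exact Finset.sum_nonneg fun i _ => hG0 i a

lemma SmoothPsi.integrable_diag (hψ : SmoothPsi D s θ₀)
    (hs : Measurable fun p : Z × Z => s p.1 p.2 θ₀) :
    Integrable (fun a => D.ψ s θ₀ a a) D.lawW := by
  obtain ⟨G, hG, hbound⟩ := hψ.exists_norm_iteratedFDeriv_le zero_le_two
  have hmeas : StronglyMeasurable fun a => D.ψ s θ₀ a a :=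
    (D.stronglyMeasurable_ψ hs).comp_measurable (measurable_id.prodMk measurable_id)
  refine hG.mono' hmeas.aestronglyMeasurable ?_
  filter_upwards [hbound] with a ha
  simpa using ha a

namespace ConvexCriterion

lemma mem (hm : ConvexCriterion D m Θ θ₀) : θ₀ ∈ Θ := mem_of_mem_nhds hm.mem_nhds

lemma eventually_add_smul_mem (hm : ConvexCriterion D m Θ θ₀) (t : RVec k) :
    ∀ᶠ τ in 𝓝[>] (0 : ℝ), θ₀ + τ • t ∈ Θ := by
  have hcont : Continuous fun τ : ℝ => θ₀ + τ • t := by fun_prop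
  exact nhdsWithin_le_nhds (hcont.continuousAt.preimage_mem_nhds (by simpa using hm.mem_nhds))

lemma integrable_diag (hm : ConvexCriterion D m Θ θ₀) {θ : RVec k} (hθ : θ ∈ Θ) :
    Integrable (fun a => D.f a * D.condPair (fun x y => m x y θ) a a) D.lawW := by
  rw [D.integrable_lawW_iff]
  refine (IntegrableOn.integrable_of_forall_notMem_eq_zero (hm.integrableOn_M₀Integrand θ hθ)
    fun a ha => ?_).congr (.of_forall fun a => ?_)
  · simp [Population.M₀Integrand, D.f_eq_zero_of_notMem_supp ha]
  · simp only [Population.M₀Integrand, smul_eq_mul]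
    ring

end ConvexCriterion

end

section

variable {d k : ℕ} {Z : Type*} [MeasurableSpace Z] {D : Population d Z}
  {m : Z → Z → RVec k → ℝ} {Θ : Set (RVec k)} {θ₀ t : RVec k}
  {s : Z → Z → RVec k → RVec k} {G₀ : RVec d → Matrix (Fin k) (Fin k) ℝ} {τ : ℝ}

lemma integral_inner_const {α E : Type*} [MeasurableSpace α] {μ : Measure α}
    [NormedAddCommGroup E] [InnerProductSpace ℝ E] [CompleteSpace E] {g : α → E}
    (hg : Integrable g μ) (c : E) : ∫ x, inner ℝ (g x) c ∂μ = inner ℝ (∫ x, g x ∂μ) c := by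
  simp only [real_inner_comm c, integral_inner hg]

lemma sub_eq_mul_remr_add_inner {Z : Type*} {m : Z → Z → RVec k → ℝ}
    {s : Z → Z → RVec k → RVec k} (hτ : τ ≠ 0) (x y : Z) :
    m x y (θ₀ + τ • t) - m x y θ₀ = τ * (remr m s t θ₀ τ x y + inner ℝ (s x y θ₀) t) := by
  rw [remr]
  field_simp
  ring

namespace LocalExpansion

lemma measurable_remr (hs : LocalExpansion D m s θ₀ G₀) (hm : ConvexCriterion D m Θ θ₀)
    (ht : θ₀ + τ • t ∈ Θ) : Measurable fun p : Z × Z => remr m s t θ₀ τ p.1 p.2 := by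
  have ht_meas := hm.measurable _ ht
  have hθ₀_meas := hm.measurable _ hm.mem
  have hs_meas := hs.measurable
  unfold remr
  fun_prop

lemma integrable_remr (hs : LocalExpansion D m s θ₀ G₀) (hm : ConvexCriterion D m Θ θ₀)
    (ht : θ₀ + τ • t ∈ Θ) :
    Integrable (fun p : Z × Z => remr m s t θ₀ τ p.1 p.2) D.pairLaw :=
  (((hm.integrable _ ht).sub (hm.integrable _ hm.mem)).div_const τ).sub
    (hs.integrable.inner_const t)

lemma ae_f_mul_condPair_sub (hs : LocalExpansion D m s θ₀ G₀) (hm : ConvexCriterion D m Θ θ₀)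
    (hτ : τ ≠ 0) (ht : θ₀ + τ • t ∈ Θ) :
    ∀ᵐ a ∂D.lawW, ∀ᵐ v ∂D.lawW,
      D.f v * D.condPair (fun x y => m x y (θ₀ + τ • t)) a v
          - D.f v * D.condPair (fun x y => m x y θ₀) a v
        = τ * inner ℝ (D.ψ s θ₀ a v) t + τ ^ 2 * D.scaledRemainder m s θ₀ t τ a v := by
  filter_upwards [
    D.ae_integrable_condPairLaw (g := fun x y => m x y (θ₀ + τ • t))
      (hm.measurable _ ht).stronglyMeasurable (hm.integrable _ ht),
    D.ae_integrable_condPairLaw (g := fun x y => m x y θ₀)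
      (hm.measurable _ hm.mem).stronglyMeasurable (hm.integrable _ hm.mem),
    D.ae_integrable_condPairLaw (hs.measurable_remr hm ht).stronglyMeasurable
      (hs.integrable_remr hm ht),
    D.ae_integrable_condPairLaw (g := fun x y => s x y θ₀) hs.measurable.stronglyMeasurable
      hs.integrable] with a ha₁ ha₀ har has
  filter_upwards [ha₁, ha₀, har, has] with v hv₁ hv₀ hvr hvs
  have hmean : D.condPair (fun x y => m x y (θ₀ + τ • t)) a v
      - D.condPair (fun x y => m x y θ₀) a v
      = τ * (D.condPair (remr m s t θ₀ τ) a v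
        + inner ℝ (D.condPair (fun x y => s x y θ₀) a v) t) := by
    unfold Population.condPair
    rw [← integral_sub hv₁ hv₀, ← integral_inner_const hvs, ← integral_add hvr (hvs.inner_const t),
      ← integral_const_mul]
    simp only [sub_eq_mul_remr_add_inner (s := s) hτ]
  rw [← mul_sub, hmean, Population.scaledRemainder, Population.ψ, real_inner_smul_left]
  field_simp
  ring

lemma f_mul_condPair_diag_sub_le (hs : LocalExpansion D m s θ₀ G₀)
    (hm : ConvexCriterion D m Θ θ₀) (hψ : SmoothPsi D s θ₀) {G : RVec d → ℝ}
    (hG : ∀ᵐ a ∂D.lawW, ∀ v ∈ D.supp, |D.scaledRemainder m s θ₀ t τ a v| ≤ G a)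
    (hτ : τ ≠ 0) (ht : θ₀ + τ • t ∈ Θ) :
    ∀ᵐ a ∂D.lawW,
      D.f a * D.condPair (fun x y => m x y (θ₀ + τ • t)) a a
          - D.f a * D.condPair (fun x y => m x y θ₀) a a
        ≤ τ * inner ℝ (D.ψ s θ₀ a a) t + τ ^ 2 * G a := by
  filter_upwards [D.ae_mem_supp, hs.ae_f_mul_condPair_sub hm hτ ht, hG, hψ.1,
    hm.tendsto_diag _ ht, hm.tendsto_diag _ hm.mem] with a ha hexp hGa hψa hlim hlim₀
  have hψlim : Tendsto (fun v => inner ℝ (D.ψ s θ₀ a v) t) (𝓝[D.supp] a)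
      (𝓝 (inner ℝ (D.ψ s θ₀ a a) t)) :=
    ((hψa.continuous.inner continuous_const).tendsto a).mono_left nhdsWithin_le_nhds
  rw [← sub_le_iff_le_add']
  refine le_of_ae_le_of_mem_support ha ((hlim.sub hlim₀).sub (hψlim.const_mul τ)) ?_
  filter_upwards [hexp, D.ae_mem_supp] with v hv hvS
  rw [hv, add_sub_cancel_left]
  exact mul_le_mul_of_nonneg_left ((le_abs_self _).trans (hGa v hvS)) (sq_nonneg τ)

lemma M₀_sub_le (hs : LocalExpansion D m s θ₀ G₀) (hm : ConvexCriterion D m Θ θ₀)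
    (hψ : SmoothPsi D s θ₀) {G : RVec d → ℝ} (hGi : Integrable G D.lawW)
    (hG : ∀ᵐ a ∂D.lawW, ∀ v ∈ D.supp, |D.scaledRemainder m s θ₀ t τ a v| ≤ G a)
    (hτ : τ ≠ 0) (ht : θ₀ + τ • t ∈ Θ) :
    D.M₀ m (θ₀ + τ • t) - D.M₀ m θ₀
      ≤ τ * inner ℝ (∫ a, D.ψ s θ₀ a a ∂D.lawW) t + τ ^ 2 * ∫ a, G a ∂D.lawW := by
  have hψi := hψ.integrable_diag hs.measurable
  have hinner := (hψi.inner_const t).const_mul τ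
  rw [D.M₀_eq_integral_lawW, D.M₀_eq_integral_lawW,
    ← integral_sub (hm.integrable_diag ht) (hm.integrable_diag hm.mem), ← integral_inner_const hψi,
    ← integral_const_mul, ← integral_const_mul, ← integral_add hinner (hGi.const_mul _)]
  exact integral_mono_ae ((hm.integrable_diag ht).sub (hm.integrable_diag hm.mem))
    (hinner.add (hGi.const_mul _)) (hs.f_mul_condPair_diag_sub_le hm hψ hG hτ ht)

theorem integral_ψ_diag_eq_zero (hs : LocalExpansion D m s θ₀ G₀)
    (hm : ConvexCriterion D m Θ θ₀) (hψ : SmoothPsi D s θ₀) :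
    ∫ a, D.ψ s θ₀ a a ∂D.lawW = 0 := by
  have hnonneg (t : RVec k) : 0 ≤ inner ℝ (∫ a, D.ψ s θ₀ a a ∂D.lawW) t := by
    obtain ⟨G, hGi, hG⟩ := hs.dominated t
    refine nonneg_of_le_mul_add_sq (g := fun τ => D.M₀ m (θ₀ + τ • t) - D.M₀ m θ₀)
      ((hm.eventually_add_smul_mem t).mono fun τ ht => sub_nonneg.2 (hm.isMinOn ht)) ?_
      (C := ∫ a, G a ∂D.lawW)
    filter_upwards [hG, hm.eventually_add_smul_mem t, self_mem_nhdsWithin]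
      with τ hGτ ht (hτ : 0 < τ)
    exact hs.M₀_sub_le hm hψ hGi hGτ hτ.ne' ht
  have hneg := hnonneg (-∫ a, D.ψ s θ₀ a a ∂D.lawW)
  rw [inner_neg_right, neg_nonneg] at hneg
  exact real_inner_self_nonpos.1 hneg

end LocalExpansion

end

/-! ### Expansion of the smoothed objective -/

section

variable {d k : ℕ} {Z : Type*} [MeasurableSpace Z] {D : Population d Z}
  {m : Z → Z → RVec k → ℝ} {Θ : Set (RVec k)} {K : RVec d → ℝ} {θ₀ t : RVec k}
  {s : Z → Z → RVec k → RVec k} {G₀ : RVec d → Matrix (Fin k) (Fin k) ℝ} {h : ℝ}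

lemma Population.M_eq_integral_scaledKernel_smul (θ : RVec k) :
    D.M m K θ h = ∫ p, scaledKernel K h (D.w p.1 - D.w p.2) • m p.1 p.2 θ ∂D.pairLaw :=
  integral_congr_ae (.of_forall fun _ => mul_comm _ _)

lemma ConvexCriterion.convexOn_M (hm : ConvexCriterion D m Θ θ₀) (hK : IsSecondOrderKernel K)
    (hh : 0 ≤ h) : ConvexOn ℝ Θ fun θ => D.M m K θ h := by
  have hi {θ : RVec k} (hθ : θ ∈ Θ) :=
    D.integrable_scaledKernel_smul (g := fun x y => m x y θ) hK (hm.integrable θ hθ) hh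
  refine ⟨hm.convex, fun x hx y hy a b ha hb hab => ?_⟩
  have hxy := ((hi hx).const_mul a).add ((hi hy).const_mul b)
  simp only [D.M_eq_integral_scaledKernel_smul]
  rw [smul_eq_mul, smul_eq_mul, ← integral_const_mul, ← integral_const_mul,
    ← integral_add ((hi hx).const_mul a) ((hi hy).const_mul b)]
  refine integral_mono_ae (hi (hm.convex hx hy ha hb hab)) hxy ?_
  filter_upwards [hm.ae_convexOn] with p hp
  have hconv := smul_le_smul_of_nonneg_left (hp.2 hx hy ha hb hab)
    (hK.scaledKernel_nonneg hh (D.w p.1 - D.w p.2))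
  simp only [smul_eq_mul] at hconv ⊢
  linarith

lemma tendsto_sq_nhdsGT_zero : Tendsto (fun h : ℝ => h ^ 2) (𝓝[>] 0) (𝓝[>] 0) := by
  refine tendsto_nhdsWithin_iff.2 ⟨?_, ?_⟩
  · simpa using ((continuous_pow 2).tendsto (0 : ℝ)).mono_left nhdsWithin_le_nhds
  · filter_upwards [self_mem_nhdsWithin] with h (hh : 0 < h) using pow_pos hh 2

namespace LocalExpansion

lemma M_add_smul_sub (hs : LocalExpansion D m s θ₀ G₀) (hm : ConvexCriterion D m Θ θ₀)
    (hK : IsSecondOrderKernel K) (hh : 0 < h) {τ : ℝ} (hτ : τ ≠ 0) (ht : θ₀ + τ • t ∈ Θ) :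
    D.M m K (θ₀ + τ • t) h - D.M m K θ₀ h
      = τ * inner ℝ (∫ a, ∫ u, D.ψ s θ₀ a (a - h • u) ∂kernelLaw K ∂D.lawW) t
        + τ ^ 2 * ∫ a, ∫ u, D.scaledRemainder m s θ₀ t τ a (a - h • u)
            ∂kernelLaw K ∂D.lawW := by
  have hr := hs.integrable_remr hm ht
  have hscore := D.integral_scaledKernel_smul (g := fun x y => s x y θ₀) hK
    hs.measurable.stronglyMeasurable hs.integrable hh
  have hrem := D.integral_scaledKernel_smul hK (hs.measurable_remr hm ht).stronglyMeasurable hr hh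
  have hsK := D.integrable_scaledKernel_smul (g := fun x y => s x y θ₀) hK hs.integrable hh.le
  have hrK := D.integrable_scaledKernel_smul hK hr hh.le
  have hf (a v : RVec d) : D.f v • D.condPair (remr m s t θ₀ τ) a v
      = τ * D.scaledRemainder m s θ₀ t τ a v := by
    rw [Population.scaledRemainder, smul_eq_mul]
    field_simp
  simp only [hf, integral_const_mul] at hrem
  unfold Population.ψ
  rw [D.M_eq_integral_scaledKernel_smul, D.M_eq_integral_scaledKernel_smul,
    ← integral_sub
      (D.integrable_scaledKernel_smul (g := fun x y => m x y _) hK (hm.integrable _ ht) hh.le)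
      (D.integrable_scaledKernel_smul (g := fun x y => m x y _) hK (hm.integrable _ hm.mem) hh.le),
    ← hscore, ← integral_inner_const hsK, pow_two, mul_assoc, ← hrem, ← mul_add,
    ← integral_add (hsK.inner_const t) hrK, ← integral_const_mul]
  simp only [real_inner_smul_left, smul_eq_mul]
  exact integral_congr_ae (.of_forall fun p => by
    linear_combination scaledKernel K h (D.w p.1 - D.w p.2) *
      sub_eq_mul_remr_add_inner (m := m) (s := s) hτ p.1 p.2)

lemma tendsto_integral_scaledRemainder (hs : LocalExpansion D m s θ₀ G₀)
    (hm : ConvexCriterion D m Θ θ₀) (hK : IsSecondOrderKernel K) (hd : 0 < d) (t : RVec k) :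
    Tendsto (fun h : ℝ => ∫ a, ∫ u, D.scaledRemainder m s θ₀ t (h ^ 2) a (a - h • u)
        ∂kernelLaw K ∂D.lawW) (𝓝[>] 0)
      (𝓝 (1 / 2 * quadForm (Matrix.of fun i j => ∫ a, G₀ a i j ∂D.lawW) t)) := by
  have := hK.isProbabilityMeasure
  obtain ⟨G, hGi, hG⟩ := hs.dominated t
  rw [← integral_quadForm hs.integrable_hessian, ← integral_const_mul]
  refine tendsto_integral_integral_sub_smul (φ := fun h => D.scaledRemainder m s θ₀ t (h ^ 2))
    (kernelLaw_singleton hd 0) D.lawW_absolutelyContinuous D.isClosed_supp.measurableSet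
    D.ae_mem_supp ?_ (fun h a v hv => ?_) hGi
    ((integrable_quadForm hs.integrable_hessian t).const_mul _)
    (tendsto_sq_nhdsGT_zero.eventually hG) ?_
  · filter_upwards [tendsto_sq_nhdsGT_zero.eventually (hm.eventually_add_smul_mem t)] with h ht
    exact ((D.measurable_f.comp measurable_snd).mul
      ((D.stronglyMeasurable_condPair
        (hs.measurable_remr hm ht).stronglyMeasurable).measurable.div_const _)).stronglyMeasurable
  · rw [Population.scaledRemainder, D.f_eq_zero_of_notMem_supp hv, zero_mul]
  · filter_upwards [hs.tendsto t] with a ha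
    exact ha.comp (tendsto_sq_nhdsGT_zero.prodMap tendsto_id)

lemma tendsto_integral_ψ (hs : LocalExpansion D m s θ₀ G₀) (hm : ConvexCriterion D m Θ θ₀)
    (hK : IsSecondOrderKernel K) (hψ : SmoothPsi D s θ₀) :
    Tendsto (fun h : ℝ => (h ^ 2)⁻¹ •
        ∫ a, ∫ u, D.ψ s θ₀ a (a - h • u) ∂kernelLaw K ∂D.lawW) (𝓝[>] 0)
      (𝓝 (∫ a, ∫ u, (1 / 2 : ℝ) • iteratedFDeriv ℝ 2 (D.ψ s θ₀ a) a (fun _ => u)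
        ∂kernelLaw K ∂D.lawW)) := by
  have := hK.isProbabilityMeasure
  have := hK.isNegInvariant
  obtain ⟨G, hGi, hG⟩ := hψ.exists_norm_iteratedFDeriv_le le_rfl
  have hbias := tendsto_integral_integral_comp_sub_smul_sub hK.integrable_norm_sq
    (D.stronglyMeasurable_ψ hs.measurable) hψ.1 hGi hG (hψ.integrable_diag hs.measurable)
  simpa only [hs.integral_ψ_diag_eq_zero hm hψ, sub_zero] using hbias

theorem tendsto_rescaled_M (hs : LocalExpansion D m s θ₀ G₀) (hm : ConvexCriterion D m Θ θ₀)
    (hK : IsSecondOrderKernel K) (hψ : SmoothPsi D s θ₀) (hd : 0 < d) (t : RVec k) :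
    Tendsto (fun h : ℝ => (h ^ 4)⁻¹ * (D.M m K (θ₀ + h ^ 2 • t) h - D.M m K θ₀ h)) (𝓝[>] 0)
      (𝓝 (1 / 2 * quadForm (Matrix.of fun i j => ∫ a, G₀ a i j ∂D.lawW) t
        + inner ℝ (∫ a, ∫ u, (1 / 2 : ℝ) • iteratedFDeriv ℝ 2 (D.ψ s θ₀ a) a (fun _ => u)
            ∂kernelLaw K ∂D.lawW) t)) := by
  refine ((hs.tendsto_integral_scaledRemainder hm hK hd t).add
    ((hs.tendsto_integral_ψ hm hK hψ).inner tendsto_const_nhds)).congr' ?_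
  filter_upwards [tendsto_sq_nhdsGT_zero.eventually (hm.eventually_add_smul_mem t),
    self_mem_nhdsWithin] with h ht (hh : 0 < h)
  rw [hs.M_add_smul_sub hm hK hh (by positivity) ht, real_inner_smul_left]
  field_simp
  ring

end LocalExpansion

end

/-! ### Consequences of the assumptions -/

section

variable {d k : ℕ} {Z : Type*} [MeasurableSpace Z] {D : Population d Z}
  {m : Z → Z → RVec k → ℝ} {Θ : Set (RVec k)} {K : RVec d → ℝ} {θ₀ t : RVec k}
  {s : Z → Z → RVec k → RVec k}
  {H : RVec d → RVec d → RVec k → RVec k → Matrix (Fin k) (Fin k) ℝ}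

lemma Population.ae_f_pos (D : Population d Z) : ∀ᵐ a ∂D.lawW, 0 < D.f a := by
  have hf := D.measurable_f
  rw [lawW, D.law_w, ae_withDensity_iff (by fun_prop)]
  exact .of_forall fun a ha => ENNReal.ofReal_pos.1 (pos_iff_ne_zero.2 ha)

lemma Population.scaledRemainder_eq_remR (τ : ℝ) (a v : RVec d) :
    D.scaledRemainder m s θ₀ t τ a v
      = D.f v * D.remR (remr m s t) H t θ₀ τ a v + 1 / 2 * (D.f v * quadForm (H a v θ₀ t) t) := by
  rw [scaledRemainder, remR]
  ring

namespace ConvergenceOfM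

lemma isSecondOrderKernel (hM : ConvergenceOfM D m Θ K θ₀)
    (hK : ∫⁻ u, ENNReal.ofReal (‖u‖ ^ 2 * K u) < ∞) : IsSecondOrderKernel K :=
  ⟨hM.K_symm, hM.K_bounded, hM.K_nonneg, hM.K_measurable, hM.K_integral, hK⟩

lemma convexCriterion (hM : ConvergenceOfM D m Θ K θ₀) : ConvexCriterion D m Θ θ₀ where
  convex := hM.Θ_convex
  mem_nhds := mem_interior_iff_mem_nhds.1 hM.θ₀_interior
  measurable := hM.m_measurable
  integrable := hM.m_integrable
  ae_convexOn := hM.m_convex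
  tendsto_diag θ hθ := by
    filter_upwards [D.ae_mem_supp, hM.m_lim θ hθ] with a ha hlim
    exact (hM.f_continuousOn a ha).mul hlim
  integrableOn_M₀Integrand := hM.M₀_integrable
  isMinOn θ hθ := by
    rcases eq_or_ne θ θ₀ with rfl | hne
    · exact le_refl (D.M₀ m θ)
    · exact (hM.θ₀_unique_min θ hθ hne).le

end ConvergenceOfM

namespace DerivativeConditions

lemma integrable_s (hs : DerivativeConditions D m s H θ₀) :
    Integrable (fun p : Z × Z => s p.1 p.2 θ₀) D.pairLaw := by
  obtain ⟨δ, hδ, b, hb, hsb, hb4, -⟩ := hs.moments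
  have hb4i : Integrable (fun z => ‖b z‖ ^ 4) D.P := by
    simp only [Real.norm_eq_abs, Even.pow_abs (show Even 4 by decide)]
    exact ⟨by fun_prop, (hasFiniteIntegral_iff_ofReal (.of_forall fun z => by positivity)).2 hb4⟩
  have hbi : Integrable b D.P :=
    ((integrable_norm_rpow_iff hb.aestronglyMeasurable (p := 4) (by simp) (by simp)).1
      (by simpa using hb4i)).integrable (by norm_num)
  refine (hbi.mul_prod hbi).mono' (hs.s_measurable θ₀).aestronglyMeasurable ?_
  filter_upwards [hsb] with p hp using hp θ₀ (Metric.mem_ball_self hδ)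

lemma exists_abs_remR_le (hs : DerivativeConditions D m s H θ₀) (t : RVec k) :
    ∃ G : RVec d → ℝ, Integrable G D.lawW ∧ ∀ᶠ τ in 𝓝[>] (0 : ℝ), ∀ᵐ a ∂D.lawW, ∀ v ∈ D.supp,
      |D.f v * D.remR (remr m s t) H t θ₀ τ a v| ≤ G a := by
  obtain ⟨δ, hδ, -, -, hmean⟩ := hs.rem_sup t
  obtain ⟨G, hG, hG0, hsup⟩ := hmean.exists_integrable
  refine ⟨G, hG, ?_⟩
  filter_upwards [Ioo_mem_nhdsGT hδ] with τ hτ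
  filter_upwards [hsup] with a ha v hv
  rw [abs_mul, abs_of_nonneg (D.f_nonneg v), mul_comm,
    ← ENNReal.ofReal_le_ofReal_iff (hG0 a)]
  refine le_trans ?_ ha
  exact le_iSup₂_of_le τ hτ <| le_iSup₂_of_le θ₀ (Metric.mem_ball_self hδ) <|
    le_iSup₂_of_le (f := fun v _ => ENNReal.ofReal (|D.remR (remr m s t) H t θ₀ τ a v| * D.f v))
      v hv le_rfl

lemma exists_abs_quadForm_le (hs : DerivativeConditions D m s H θ₀) (t : RVec k) :
    ∃ G : RVec d → ℝ, Integrable G D.lawW ∧ ∀ᵐ a ∂D.lawW, ∀ v ∈ D.supp,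
      |D.f v * quadForm (H a v θ₀ t) t| ≤ G a := by
  obtain ⟨δ, hδ, b, -, -, -, -, hmean⟩ := hs.moments
  obtain ⟨G, hG, hG0, hsup⟩ := (hmean t).exists_integrable
  refine ⟨fun a => G a * ‖t‖ ^ 2, hG.mul_const _, ?_⟩
  filter_upwards [hsup] with a ha v hv
  have hHG : matNorm (H a v θ₀ t) * D.f v ≤ G a := by
    rw [← ENNReal.ofReal_le_ofReal_iff (hG0 a)]
    refine le_trans ?_ ha
    exact le_iSup₂_of_le θ₀ (Metric.mem_ball_self hδ) <|
      le_iSup₂_of_le (f := fun v _ => ENNReal.ofReal (matNorm (H a v θ₀ t) * D.f v)) v hv le_rfl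
  calc |D.f v * quadForm (H a v θ₀ t) t| = D.f v * |quadForm (H a v θ₀ t) t| := by
        rw [abs_mul, abs_of_nonneg (D.f_nonneg v)]
    _ ≤ D.f v * (matNorm (H a v θ₀ t) * ‖t‖ ^ 2) :=
        mul_le_mul_of_nonneg_left (abs_quadForm_le _ t) (D.f_nonneg v)
    _ = matNorm (H a v θ₀ t) * D.f v * ‖t‖ ^ 2 := by ring
    _ ≤ G a * ‖t‖ ^ 2 := by gcongr

lemma exists_abs_scaledRemainder_le (hs : DerivativeConditions D m s H θ₀) (t : RVec k) :
    ∃ G : RVec d → ℝ, Integrable G D.lawW ∧ ∀ᶠ τ in 𝓝[>] (0 : ℝ), ∀ᵐ a ∂D.lawW, ∀ v ∈ D.supp,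
      |D.scaledRemainder m s θ₀ t τ a v| ≤ G a := by
  obtain ⟨G, hG, hR⟩ := hs.exists_abs_remR_le t
  obtain ⟨G', hG', hH⟩ := hs.exists_abs_quadForm_le t
  refine ⟨fun a => G a + 1 / 2 * G' a, hG.add (hG'.const_mul _), ?_⟩
  filter_upwards [hR] with τ hτ
  filter_upwards [hτ, hH] with a hRa hHa v hv
  rw [D.scaledRemainder_eq_remR (H := H)]
  refine (abs_add_le _ _).trans (add_le_add (hRa v hv) ?_)
  rw [abs_mul, abs_of_pos one_half_pos]
  exact mul_le_mul_of_nonneg_left (hHa v hv) one_half_pos.le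

end DerivativeConditions

lemma tendsto_f_mul_remR (hs : DerivativeConditions D m s H θ₀) (hM : ConvergenceOfM D m Θ K θ₀)
    (t : RVec k) :
    ∀ᵐ a ∂D.lawW, Tendsto
      (fun p : ℝ × RVec d => D.f p.2 * D.remR (remr m s t) H t θ₀ p.1 a p.2)
      (𝓝[>] 0 ×ˢ 𝓝[D.supp \ {a}] a) (𝓝 0) := by
  filter_upwards [D.ae_mem_supp, hs.rem_lim_R t] with a ha hR
  have hle : 𝓝[D.supp \ {a}] a ≤ 𝓝[D.supp] a := nhdsWithin_mono a Set.sdiff_subset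
  have hf : Tendsto (fun p : ℝ × RVec d => D.f p.2) (𝓝[>] 0 ×ˢ 𝓝[D.supp \ {a}] a) (𝓝 (D.f a)) :=
    ((hM.f_continuousOn a ha).mono_left hle).comp tendsto_snd
  have hpath : Tendsto (fun p : ℝ × RVec d => (p.1, θ₀, p.2)) (𝓝[>] 0 ×ˢ 𝓝[D.supp \ {a}] a)
      (limTauThetaV D.supp θ₀ a) :=
    tendsto_fst.prodMk (tendsto_const_nhds.prodMk (tendsto_snd.mono_right hle))
  simpa using hf.mul (hR.comp hpath)

lemma tendsto_f_mul_quadForm (hM : ConvergenceOfM D m Θ K θ₀)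
    {G₀ : RVec d → Matrix (Fin k) (Fin k) ℝ}
    (hG₀ : ∀ᵐ a ∂D.lawW, Tendsto (fun q : RVec k × RVec d => D.f a • H a q.2 q.1 t)
      (limThetaV D.supp θ₀ a) (𝓝 (G₀ a))) :
    ∀ᵐ a ∂D.lawW, Tendsto (fun v => D.f v * quadForm (H a v θ₀ t) t) (𝓝[D.supp \ {a}] a)
      (𝓝 (quadForm (G₀ a) t)) := by
  filter_upwards [D.ae_mem_supp, D.ae_f_pos, hG₀] with a ha hpos hlim
  have hpath : Tendsto (fun v : RVec d => (θ₀, v)) (𝓝[D.supp \ {a}] a)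
      (limThetaV D.supp θ₀ a) := by
    refine tendsto_nhdsWithin_iff.2
      ⟨(Continuous.tendsto (by fun_prop) a).mono_left nhdsWithin_le_nhds, ?_⟩
    filter_upwards [self_mem_nhdsWithin] with v hv
    exact ⟨hv.1, fun heq => hv.2 (congrArg Prod.snd heq)⟩
  have hquad := ((continuous_quadForm t).tendsto _).comp (hlim.comp hpath)
  have hf : Tendsto (fun v => D.f v / D.f a) (𝓝[D.supp \ {a}] a) (𝓝 1) := by
    simpa [div_self hpos.ne'] using ((hM.f_continuousOn a ha).mono_left
      (nhdsWithin_mono a Set.sdiff_subset)).div_const (D.f a)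
  refine (one_mul (quadForm (G₀ a) t) ▸ hf.mul hquad).congr fun v => ?_
  simp only [Function.comp_apply, quadForm_smul]
  field_simp

lemma DerivativeConditions.exists_localExpansion (hs : DerivativeConditions D m s H θ₀)
    (hM : ConvergenceOfM D m Θ K θ₀) :
    ∃ G₀ : RVec d → Matrix (Fin k) (Fin k) ℝ, LocalExpansion D m s θ₀ G₀ := by
  obtain ⟨G₀, ξ₀, Ξ₀, hV⟩ := hs.variance
  refine ⟨G₀, hs.s_measurable θ₀, hs.integrable_s, hs.exists_abs_scaledRemainder_le, fun t => ?_,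
    hV.G₀_integrable, hV.Γ₀_posDef⟩
  filter_upwards [tendsto_f_mul_remR hs hM t, tendsto_f_mul_quadForm hM (hV.G₀_lim t)]
    with a hR hH
  simp only [D.scaledRemainder_eq_remR (H := H)]
  simpa only [zero_add, Function.comp_apply] using
    hR.add ((hH.comp tendsto_snd).const_mul (1 / 2))

end

end PairwiseDiff

end

theorem proposition1_general {d k : ℕ} (hd : 0 < d) {Z : Type*} [MeasurableSpace Z]
    {D : PairwiseDiff.Population d Z} {m : Z → Z → PairwiseDiff.RVec k → ℝ}
    {Θ : Set (PairwiseDiff.RVec k)} {K : PairwiseDiff.RVec d → ℝ} {θ₀ : PairwiseDiff.RVec k}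
    {s : Z → Z → PairwiseDiff.RVec k → PairwiseDiff.RVec k}
    {G₀ : PairwiseDiff.RVec d → Matrix (Fin k) (Fin k) ℝ}
    (hK : PairwiseDiff.IsSecondOrderKernel K) (hm : PairwiseDiff.ConvexCriterion D m Θ θ₀)
    (hs : PairwiseDiff.LocalExpansion D m s θ₀ G₀) (hψ : PairwiseDiff.SmoothPsi D s θ₀) :
    (∀ᶠ h in 𝓝[>] (0 : ℝ), (D.argminM m Θ K h).Nonempty) ∧
    ∃ b₂ : PairwiseDiff.RVec k, ∀ θ : ℝ → PairwiseDiff.RVec k,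
      (∀ᶠ h in 𝓝[>] (0 : ℝ), θ h ∈ D.argminM m Θ K h) →
      (fun h : ℝ => θ h - θ₀ - h ^ 2 • b₂) =o[𝓝[>] (0 : ℝ)] (fun h : ℝ => h ^ 2) := by
  have hpos : ∀ᶠ h in 𝓝[>] (0 : ℝ), 0 < h := self_mem_nhdsWithin
  have hconv : ∀ᶠ h in 𝓝[>] (0 : ℝ), ConvexOn ℝ Θ fun θ => D.M m K θ h :=
    hpos.mono fun h hh => hm.convexOn_M hK hh.le
  have hscale : ∀ᶠ h in 𝓝[>] (0 : ℝ), 0 < (h ^ 4)⁻¹ := hpos.mono fun h hh => by positivity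
  have hlim := hs.tendsto_rescaled_M hm hK hψ hd
  obtain ⟨b₂, hb₂⟩ := PairwiseDiff.exists_unique_min_quadForm_add_inner hs.posDef_hessian
    (∫ a, ∫ u, (1 / 2 : ℝ) • iteratedFDeriv ℝ 2 (D.ψ s θ₀ a) a (fun _ => u)
      ∂PairwiseDiff.kernelLaw K ∂D.lawW)
  exact ⟨PairwiseDiff.eventually_exists_isMinOn_of_tendsto_rescale hconv hm.mem_nhds
      PairwiseDiff.tendsto_sq_nhdsGT_zero hscale hlim hb₂,
    b₂, fun θ hθ => PairwiseDiff.isLittleO_of_isMinOn_of_tendsto_rescale hconv hm.mem_nhds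
      PairwiseDiff.tendsto_sq_nhdsGT_zero hscale hlim hb₂ hθ⟩

theorem proposition1 {d k : ℕ} (hd : 0 < d) {Z : Type*} [MeasurableSpace Z]
    (D : PairwiseDiff.Population d Z)
    (m : Z → Z → PairwiseDiff.RVec k → ℝ) (Θ : Set (PairwiseDiff.RVec k))
    (K : PairwiseDiff.RVec d → ℝ) (θ₀ : PairwiseDiff.RVec k)
    (s : Z → Z → PairwiseDiff.RVec k → PairwiseDiff.RVec k)
    (H : PairwiseDiff.RVec d → PairwiseDiff.RVec d → PairwiseDiff.RVec k →
      PairwiseDiff.RVec k → Matrix (Fin k) (Fin k) ℝ)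
    (hM : PairwiseDiff.ConvergenceOfM D m Θ K θ₀)
    (hs : PairwiseDiff.DerivativeConditions D m s H θ₀)
    (hK : ∫⁻ u, ENNReal.ofReal (‖u‖ ^ 2 * K u) < ⊤)
    (hψ : PairwiseDiff.SmoothPsi D s θ₀) :
    (∀ᶠ h in 𝓝[>] (0 : ℝ), (D.argminM m Θ K h).Nonempty) ∧
    ∃ b₂ : PairwiseDiff.RVec k, ∀ θ : ℝ → PairwiseDiff.RVec k,
      (∀ᶠ h in 𝓝[>] (0 : ℝ), θ h ∈ D.argminM m Θ K h) →
      (fun h : ℝ => θ h - θ₀ - h ^ 2 • b₂) =o[𝓝[>] (0 : ℝ)] (fun h : ℝ => h ^ 2) := by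
  obtain ⟨G₀, hG⟩ := hs.exists_localExpansion hM
  exact proposition1_general hd (hM.isSecondOrderKernel hK) hM.convexCriterion hG hψ
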